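/- **Definitions.** All graphs are finite and simple. For a graph $H$ and $k\ge 2$, the edge blow-up $H^{k}$ is obtained from $H$ by replacing each edge by a clique on $k$ vertices (containing the two ends of the edge), where the new vertices of the cliques are all distinct. $G\cup H$ is the disjoint union and $G+H$ the join of $G$ and $H$; $I_v=\overline K_v$ is the edgeless graph on $v$ vertices; $T(n,r)$ is the $r$-partite Turán graph on $n$ vertices; $\alpha$ is the independence number; $\delta_T(A)=\min\{\deg_T(x): x\in A\}$. For a family $\mathcal F$ of graphs, $\mathrm{ex}(n,\mathcal F)$ is the maximum number of edges of a graph on $n$ vertices that contains no member of $\mathcal F$ as a (not necessarily induced) subgraph, and $\mathrm{EX}(n,\mathcal F)$ is the set of such graphs with exactly $\mathrm{ex}(n,\mathcal F)$ edges; for a single graph $L$ we write $\mathrm{ex}(n,L)$ and $\mathrm{EX}(n,L)$. For a graph $L$ with chromatic number $\chi(L)\ge 3$, the decomposition family $\mathcal M(L)$ consists of the graphs $M$ that are minimal, with respect to the subgraph relation, with the property that $L$ is a subgraph of $(M\cup I_v)+T(t,\chi(L)-2)$ for some $v$ and $t$. A covering of a graph is a set of vertices meeting every edge. For a bipartite graph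 $F$, $q(F)$ is the minimum size of a covering of $F$ that is an independent set, and for a family $\mathcal F$ containing a bipartite graph, $q(\mathcal F)=\min\{q(F): F\in\mathcal F,\ F\text{ bipartite}\}$. **Theorem.** Let $p\ge 3$ be an integer and let $T$ be a tree with colour classes $A$ and $B$, $|A|\le|B|$, such that $\delta_T(A)=1$ and $\alpha(T)>|B|$. Put $\mathcal M=\mathcal M(T^{p+1})$ (note $\chi(T^{p+1})=p+1$) and $q=q(\mathcal M)$. If some member of $\mathcal M$ has a covering with at most $q-1$ vertices, let $\mathcal B$ be the family of all induced subgraphs $F[U]$, where $F\in\mathcal M$ and $U$ is a covering of $F$ with $|U|\le q-1$; otherwise let $\mathcal B=\{K_q\}$. Let $h'(n,p,q)$ be the number of edges of $H'(n,p,q)=\overline K_{q-1}+T(n-q+1,p)$. Then there is an $n_0$ (depending on $p$ and $T$) such that for all $n\ge n_0$ $$\mathrm{ex}(n,T^{p+1})=h'(n,p,q)+\mathrm{ex}(q-1,\mathcal B),$$ and a graph $G$ on $n$ vertices belongs to $\mathrm{EX}(n,T^{p+1})$ if and only if $G$ is isomorphic to a graph obtained from $H'(n,p,q)$ by embedding some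 $Q\in\mathrm{EX}(q-1,\mathcal B)$ in its part $\overline K_{q-1}$, that is, to $Q+T(n-q+1,p)$. -/

import Mathlib

noncomputable section

namespace BlowupTuran

open scoped SimpleGraph

/-- The join of two vertex-disjoint graphs: their disjoint union together with all edges
between them. -/
def join {V W : Type*} (G : SimpleGraph V) (H : SimpleGraph W) : SimpleGraph (V ⊕ W) :=
  (G ⊕g H) ⊔ completeBipartiteGraph V W

/-- The vertex set of the clique of the edge blow-up of `H` that replaces the edge `e`: the two
ends of `e` and the `k - 2` new vertices that belong to `e`. -/
def blowupClique {V : Type*} (H : SimpleGraph V) (k : ℕ) (e : H.edgeSet) :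
    Set (V ⊕ H.edgeSet × Fin (k - 2)) :=
  {x | (∃ v ∈ (e : Sym2 V), x = Sum.inl v) ∨ ∃ i, x = Sum.inr (e, i)}

/-- The edge blow-up `H^k` (for `k ≥ 2`): every edge of `H` is replaced by a clique on `k`
vertices, where the new vertices of the cliques are all distinct. -/
def edgeBlowup {V : Type*} (H : SimpleGraph V) (k : ℕ) :
    SimpleGraph (V ⊕ H.edgeSet × Fin (k - 2)) where
  Adj x y := x ≠ y ∧ ∃ e : H.edgeSet, x ∈ blowupClique H k e ∧ y ∈ blowupClique H k e
  symm := ⟨fun _ _ h => ⟨h.1.symm, h.2.imp fun _ he => ⟨he.2, he.1⟩⟩⟩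
  loopless := ⟨fun _ h => h.1 rfl⟩

/-- `δ_H(A)`, the minimum degree in `H` of the vertices in `A`. -/
def minDegreeOn {V : Type*} (H : SimpleGraph V) (A : Set V) : ℕ :=
  sInf ((fun x => (H.neighborSet x).ncard) '' A)

/-- A family of finite graphs. -/
abbrev GraphFamily : Type := Set (Σ m : ℕ, SimpleGraph (Fin m))

/-- `G` contains no copy of a member of `𝓕` as a (not necessarily induced) subgraph. -/
def FamilyFree {V : Type*} (𝓕 : GraphFamily) (G : SimpleGraph V) : Prop :=
  ∀ F ∈ 𝓕, F.2.Free G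

/-- `ex(n, 𝓕)`, the maximum number of edges of an `𝓕`-free graph on `n` vertices. -/
def familyEx (n : ℕ) (𝓕 : GraphFamily) : ℕ :=
  sSup {e | ∃ G : SimpleGraph (Fin n), FamilyFree 𝓕 G ∧ G.edgeSet.ncard = e}

/-- `EX(n, 𝓕)`, the `𝓕`-free graphs on `n` vertices with `ex(n, 𝓕)` edges. -/
def familyEX (n : ℕ) (𝓕 : GraphFamily) : Set (SimpleGraph (Fin n)) :=
  {G | FamilyFree 𝓕 G ∧ G.edgeSet.ncard = familyEx n 𝓕}

/-- `EX(n, L)`, the `L`-free graphs on `n` vertices with `ex(n, L)` edges. -/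
def graphEX {W : Type*} (n : ℕ) (L : SimpleGraph W) : Set (SimpleGraph (Fin n)) :=
  {G | L.Free G ∧ G.edgeSet.ncard = SimpleGraph.extremalNumber n L}

/-- `L` is a subgraph of `(M ∪ I_v) + T(t, χ(L) - 2)` for some `v` and `t`, where `I_v` is the
edgeless graph on `v` vertices and `T(t, r)` the Turán graph. (Meant for `χ(L) ≥ 3`.) -/
def Decomposes {W : Type*} (L : SimpleGraph W) {m : ℕ} (M : SimpleGraph (Fin m)) : Prop :=
  ∃ v t : ℕ, L ⊑ join (M ⊕g (⊥ : SimpleGraph (Fin v)))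
    (SimpleGraph.turanGraph t (L.chromaticNumber.toNat - 2))

/-- The decomposition family `𝓜(L)`: the graphs `M` that are minimal, with respect to the
subgraph relation, with the property `Decomposes L M`. -/
def decompositionFamily {W : Type*} (L : SimpleGraph W) : GraphFamily :=
  {M | Decomposes L M.2 ∧
    ∀ M' : Σ m : ℕ, SimpleGraph (Fin m), Decomposes L M'.2 → M'.2 ⊑ M.2 → M.2 ⊑ M'.2}

/-- `q(F)` for a bipartite graph `F`: the minimum order of an independent covering. -/
def indepCoverNum {V : Type*} (F : SimpleGraph V) : ℕ :=
  sInf {k | ∃ U : Finset V, F.IsVertexCover (U : Set V) ∧ F.IsIndepSet (U : Set V) ∧ U.card = k}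

/-- `q(𝓕)`: the minimum of `q(F)` over the bipartite members `F` of `𝓕`. -/
def familyIndepCoverNum (𝓕 : GraphFamily) : ℕ :=
  sInf {k | ∃ F ∈ 𝓕, F.2.IsBipartite ∧ indepCoverNum F.2 = k}

open Classical in
/-- The family `𝓑` attached to `𝓜`, where `q = q(𝓜)`: all graphs induced by a member of `𝓜` on a
covering of it with fewer than `q` vertices if some member has such a covering, and `{K_q}`
otherwise. -/
def coveringFamily (𝓜 : GraphFamily) : GraphFamily :=
  if ∃ F ∈ 𝓜, F.2.vertexCoverNum < (familyIndepCoverNum 𝓜 : ℕ∞) then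
    {Q | ∃ F ∈ 𝓜, ∃ U : Finset (Fin F.1), F.2.IsVertexCover (U : Set (Fin F.1)) ∧
      U.card < familyIndepCoverNum 𝓜 ∧ Nonempty (Q.2 ≃g F.2.induce (U : Set (Fin F.1)))}
  else {⟨familyIndepCoverNum 𝓜, ⊤⟩}

/-- The graph obtained from `H'(n, p, q)` by embedding `Q` in its part `K̄_{q-1}`, that is, the
join of `Q` and the Turán graph `T(n - q + 1, p)`. -/
def turanWith (n p q : ℕ) (Q : SimpleGraph (Fin (q - 1))) :
    SimpleGraph (Fin (q - 1) ⊕ Fin (n - (q - 1))) :=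
  join Q (SimpleGraph.turanGraph (n - (q - 1)) p)

/-- `h'(n, p, q)`, the number of edges of `H'(n, p, q) = K̄_{q-1} + T(n - q + 1, p)`. -/
def hPrime (n p q : ℕ) : ℕ :=
  (turanWith n p q ⊥).edgeSet.ncard

end BlowupTuran

end

open BlowupTuran

/-!
Let `L = T^{p+1}`. An independent set `C` of `T` splits `L` into a star forest and a
`(p - 1)`-partite remainder: each vertex of `C` is the centre of a star with one leaf for each
edge of `T` at that vertex, and each edge of `T` that misses `C` contributes an isolated edge.
Then `q` is the least number of stars that arises in this way. An optimal `C` may be chosen such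
that one of the stars is a single edge: either some edge of `T` misses `C`, or `C` is a colour
class, and then `C = A` will do because of `δ_T(A) = 1`. So `L` is contained in the join of
`q - 1` large stars and one further edge with a complete `(p - 1)`-partite graph, and, taking
`C = ∅`, also in the join of a matching with such a graph.

Let `G` be an extremal graph on `n` vertices. Deleting a vertex of small degree, or a clique `K_p`
of small degree sum, increases the excess of the number of edges over that of `H'(n, p, q)`, so by
progressive induction `G` may be assumed to have neither. As `G` omits the join with a matching,
it is close to a Turán graph. As it omits the join with the stars and the further edge, at most
`q - 1` vertices have many neighbours in all classes, and by the condition on degree sums there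
are exactly `q - 1`, which are joined to large subsets of all classes. An edge inside a class
would extend the stars at these vertices to the excluded join, so the other vertices induce a
`p`-partite graph, and `G` has at most as many edges as `Q + T(n - q + 1, p)`, where `Q` is
induced by the exceptional vertices.

Finally, `Q + T(n - q + 1, p)` is `L`-free if and only if `Q` is `𝓑`-free: in a copy of `L`, the
part in `Q` together with one class of the Turán graph contains a member of the decomposition
family that is covered by its vertices in `Q`.
-/

namespace BlowupTuran

open SimpleGraph Finset
open scoped Classical

section Copies

variable {V W X : Type*} {G : SimpleGraph V} {H : SimpleGraph W} {K : SimpleGraph X}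

@[simp] lemma join_adj_inl_inl {a b : V} : (join G H).Adj (.inl a) (.inl b) ↔ G.Adj a b := by
  simp [join]

@[simp] lemma join_adj_inr_inr {a b : W} : (join G H).Adj (.inr a) (.inr b) ↔ H.Adj a b := by
  simp [join]

@[simp] lemma join_adj_inl_inr {a : V} {b : W} : (join G H).Adj (.inl a) (.inr b) := by
  simp [join]

@[simp] lemma join_adj_inr_inl {a : W} {b : V} : (join G H).Adj (.inr a) (.inl b) := by
  simp [join]

/-- The copy of a join given by copies of its two parts that are completely joined to each
other. -/
def joinCopy (f : Copy G K) (g : Copy H K) (h : ∀ v w, K.Adj (f v) (g w)) : Copy (join G H) K where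
  toHom :=
    { toFun := Sum.elim f g
      map_rel' := by
        rintro (a | a) (b | b) hab
        · exact f.toHom.map_adj (join_adj_inl_inl.1 hab)
        · exact h a b
        · exact (h b a).symm
        · exact g.toHom.map_adj (join_adj_inr_inr.1 hab) }
  injective' := f.injective.sumElim g.injective fun v w => (h v w).ne

/-- The copy of a disjoint union given by disjoint copies of its two parts. -/
def sumCopy (f : Copy G K) (g : Copy H K) (h : ∀ v w, f v ≠ g w) : Copy (G ⊕g H) K where
  toHom :=
    { toFun := Sum.elim f g
      map_rel' := by
        rintro (a | a) (b | b) hab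
        · exact f.toHom.map_adj (sum_adj_inl.1 hab)
        · simp at hab
        · simp at hab
        · exact g.toHom.map_adj (sum_adj_inr.1 hab) }
  injective' := f.injective.sumElim g.injective h

/-- The copy of a single edge given by two adjacent vertices. -/
def edgeCopy {y z : X} (h : K.Adj y z) : Copy (⊤ : SimpleGraph (Fin 2)) K where
  toHom :=
    { toFun := ![y, z]
      map_rel' := fun {a b} hab => by
        fin_cases a <;> fin_cases b
        exacts [absurd rfl hab, h, h.symm, absurd rfl hab] }
  injective' := fun a b hab => by
    fin_cases a <;> fin_cases b
    exacts [rfl, absurd hab h.ne, absurd hab h.ne', rfl]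

lemma edgeCopy_mem {y z : X} (h : K.Adj y z) (w : Fin 2) : edgeCopy h w ∈ ({y, z} : Finset X) := by
  fin_cases w
  exacts [mem_insert_self y {z}, mem_insert_of_mem (mem_singleton_self z)]

lemma join_isContained_join {V' W' : Type*} {G' : SimpleGraph V'} {H' : SimpleGraph W'}
    (hG : G ⊑ G') (hH : H ⊑ H') : join G H ⊑ join G' H' := by
  obtain ⟨f⟩ := hG
  obtain ⟨g⟩ := hH
  refine ⟨⟨⟨Sum.map f g, ?_⟩, Sum.map_injective.2 ⟨f.injective, g.injective⟩⟩⟩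
  rintro (a | a) (b | b) hab
  · exact join_adj_inl_inl.2 (f.toHom.map_adj (join_adj_inl_inl.1 hab))
  · exact join_adj_inl_inr
  · exact join_adj_inr_inl
  · exact join_adj_inr_inr.2 (g.toHom.map_adj (join_adj_inr_inr.1 hab))

end Copies

section Neighbours

variable {V : Type*} {G : SimpleGraph V} {D E S T : Finset V} {x : V}

/-- The neighbours of `x` in the vertex set `D`. -/
noncomputable def nbrsIn (G : SimpleGraph V) (D : Finset V) (x : V) : Finset V :=
  {v ∈ D | G.Adj x v}

/-- The vertices of `D` that are not adjacent to `x`, including `x` itself if `x ∈ D`. -/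
noncomputable def nonNbrsIn (G : SimpleGraph V) (D : Finset V) (x : V) : Finset V :=
  {v ∈ D | ¬ G.Adj x v}

/-- The vertices of `D` that are adjacent to all vertices of `S`. -/
noncomputable def commonNbrsIn (G : SimpleGraph V) (D S : Finset V) : Finset V :=
  {v ∈ D | ∀ x ∈ S, G.Adj x v}

@[simp] lemma mem_nbrsIn {v : V} : v ∈ nbrsIn G D x ↔ v ∈ D ∧ G.Adj x v := mem_filter

@[simp] lemma mem_nonNbrsIn {v : V} : v ∈ nonNbrsIn G D x ↔ v ∈ D ∧ ¬ G.Adj x v := mem_filter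

@[simp] lemma mem_commonNbrsIn {v : V} : v ∈ commonNbrsIn G D S ↔ v ∈ D ∧ ∀ x ∈ S, G.Adj x v :=
  mem_filter

lemma nbrsIn_subset : nbrsIn G D x ⊆ D := filter_subset _ _

lemma commonNbrsIn_subset : commonNbrsIn G D S ⊆ D := filter_subset _ _

lemma commonNbrsIn_anti (h : S ⊆ T) : commonNbrsIn G D T ⊆ commonNbrsIn G D S :=
  monotone_filter_right _ fun _ _ hv x hx => hv x (h hx)

lemma commonNbrsIn_mono (h : D ⊆ E) : commonNbrsIn G D S ⊆ commonNbrsIn G E S :=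
  filter_subset_filter _ h

lemma nonNbrsIn_mono (h : D ⊆ E) : nonNbrsIn G D x ⊆ nonNbrsIn G E x := filter_subset_filter _ h

@[simp] lemma commonNbrsIn_empty : commonNbrsIn G D ∅ = D := by simp [commonNbrsIn]

lemma card_nbrsIn_add_card_nonNbrsIn (G : SimpleGraph V) (D : Finset V) (x : V) :
    #(nbrsIn G D x) + #(nonNbrsIn G D x) = #D :=
  card_filter_add_card_filter_not _

lemma card_commonNbrsIn_le_card_union_add {l : ℕ} (h : ∀ u ∈ T, #(nonNbrsIn G D u) ≤ l) :
    #(commonNbrsIn G D S) ≤ #(commonNbrsIn G D (S ∪ T)) + #T * l := by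
  have hsub : commonNbrsIn G D S ⊆ commonNbrsIn G D (S ∪ T) ∪ T.biUnion (nonNbrsIn G D) := by
    intro v hv
    simp only [mem_commonNbrsIn, mem_union, mem_biUnion, mem_nonNbrsIn] at hv ⊢
    by_cases hT : ∀ u ∈ T, G.Adj u v
    · exact .inl ⟨hv.1, fun x hx => hx.elim (hv.2 x) (hT x)⟩
    · push Not at hT
      obtain ⟨u, hu, huv⟩ := hT
      exact .inr ⟨u, hu, hv.1, huv⟩
  calc #(commonNbrsIn G D S)
      ≤ #(commonNbrsIn G D (S ∪ T)) + #(T.biUnion (nonNbrsIn G D)) :=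
        (card_le_card hsub).trans (card_union_le _ _)
    _ ≤ _ := Nat.add_le_add_left (card_biUnion_le_card_mul _ _ _ h) _

lemma card_le_card_commonNbrsIn_add {l : ℕ} (h : ∀ u ∈ T, #(nonNbrsIn G D u) ≤ l) :
    #D ≤ #(commonNbrsIn G D T) + #T * l := by
  simpa using card_commonNbrsIn_le_card_union_add (S := ∅) h

end Neighbours

section AlmostJoined

variable {V W ι : Type*} {G : SimpleGraph V} {r s δ : ℕ}

/-- Every vertex of one of the sets `D i` is adjacent to all but at most `δ` vertices of each of the
other sets. -/
def AlmostJoined (G : SimpleGraph V) (δ : ℕ) (D : ι → Finset V) : Prop :=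
  Pairwise fun i j => ∀ u ∈ D i, #(nonNbrsIn G (D j) u) ≤ δ

lemma AlmostJoined.mono {D E : ι → Finset V} (hE : AlmostJoined G δ E) (h : ∀ i, D i ⊆ E i) :
    AlmostJoined G δ D := fun i j hij u hu =>
  (card_le_card (nonNbrsIn_mono (h j))).trans (hE hij u (h i hu))

lemma AlmostJoined.comp_injective {κ : Type*} {D : ι → Finset V} (hD : AlmostJoined G δ D)
    {e : κ → ι} (he : Function.Injective e) : AlmostJoined G δ (D ∘ e) :=
  fun _ _ hij => hD (he.ne hij)

lemma AlmostJoined.exists_completelyJoined [Fintype ι] {D : ι → Finset V}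
    (hD : AlmostJoined G δ D) (hcard : ∀ j, Fintype.card ι * (s * δ) + s ≤ #(D j)) :
    ∃ D' : ι → Finset V, (∀ j, D' j ⊆ D j) ∧ (∀ j, #(D' j) = s) ∧
      Pairwise fun i j => ∀ u ∈ D' i, ∀ v ∈ D' j, G.Adj u v := by
  suffices ∀ S : Finset ι, ∃ D' : ι → Finset V, (∀ j ∈ S, D' j ⊆ D j) ∧ (∀ j ∈ S, #(D' j) = s) ∧
      (S : Set ι).Pairwise fun i j => ∀ u ∈ D' i, ∀ v ∈ D' j, G.Adj u v by
    obtain ⟨D', hsub, hs, hadj⟩ := this univ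
    exact ⟨D', fun j => hsub j (mem_univ j), fun j => hs j (mem_univ j),
      fun i j hij => hadj (by simp) (by simp) hij⟩
  intro S
  induction S using Finset.induction_on with
  | empty => exact ⟨fun _ => ∅, by simp⟩
  | insert i S hi ih =>
    obtain ⟨D', hsub, hs, hadj⟩ := ih
    have hmiss : ∀ u ∈ S.biUnion D', #(nonNbrsIn G (D i) u) ≤ δ := fun u hu => by
      obtain ⟨j, hj, huj⟩ := mem_biUnion.1 hu
      exact hD (ne_of_mem_of_not_mem hj hi) u (hsub j hj huj)
    have hunion : #(S.biUnion D') * δ ≤ Fintype.card ι * (s * δ) := by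
      rw [← mul_assoc]
      exact Nat.mul_le_mul_right _ ((card_biUnion_le_card_mul _ _ _ fun j hj => (hs j hj).le).trans
        (Nat.mul_le_mul_right _ (card_le_univ S)))
    obtain ⟨A, hA, hAs⟩ := exists_subset_card_eq (s := commonNbrsIn G (D i) (S.biUnion D')) (n := s)
      (by have := card_le_card_commonNbrsIn_add hmiss; have := hcard i; omega)
    have hAD' : ∀ j ∈ S, ∀ u ∈ D' j, ∀ v ∈ A, G.Adj u v := fun j hj u hu v hv =>
      (mem_commonNbrsIn.1 (hA hv)).2 u (mem_biUnion.2 ⟨j, hj, hu⟩)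
    have hupd : ∀ j ∈ S, Function.update D' i A j = D' j := fun j hj =>
      Function.update_of_ne (ne_of_mem_of_not_mem hj hi) _ _
    refine ⟨Function.update D' i A, ?_, ?_, ?_⟩
    · simpa +contextual [hupd] using And.intro (hA.trans commonNbrsIn_subset) hsub
    · simpa +contextual [hupd] using And.intro hAs hs
    · rw [coe_insert, Set.pairwise_insert]
      refine ⟨fun j hj k hk hjk => ?_, fun j hj _ => ?_⟩
      · simp only [hupd j hj, hupd k hk]
        exact hadj hj hk hjk
      · simp only [hupd j hj, Function.update_self]
        exact ⟨fun u hu v hv => (hAD' j hj v hv u hu).symm, hAD' j hj⟩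

lemma exists_copy_completeEquipartiteGraph {D : Fin r → Finset V} (hcard : ∀ j, s ≤ #(D j))
    (hD : Pairwise fun i j => ∀ u ∈ D i, ∀ v ∈ D j, G.Adj u v) :
    ∃ g : Copy (completeEquipartiteGraph r s) G, ∀ x, g x ∈ D x.1 := by
  have hemb : ∀ j, ∃ g : Fin s ↪ V, ∀ i, g i ∈ D j := fun j => by
    obtain ⟨D', hD', hs⟩ := exists_subset_card_eq (hcard j)
    exact ⟨(D'.equivFinOfCardEq hs).symm.toEmbedding.trans (.subtype _),
      fun i => hD' (Subtype.prop _)⟩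
  choose g hg using hemb
  have hadj : ∀ x y : Fin r × Fin s, x.1 ≠ y.1 → G.Adj (g x.1 x.2) (g y.1 y.2) :=
    fun x y hxy => hD hxy _ (hg _ _) _ (hg _ _)
  refine ⟨⟨⟨fun x => g x.1 x.2, fun {x y} hxy => hadj x y hxy⟩, ?_⟩, fun x => hg _ _⟩
  rintro ⟨i, a⟩ ⟨j, b⟩ hab
  obtain rfl : i = j := by
    by_contra hij
    exact (hadj (i, a) (j, b) hij).ne hab
  exact Prod.ext rfl ((g i).injective hab)

lemma AlmostJoined.join_isContained {M : SimpleGraph W} {D : Fin r → Finset V}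
    (hD : AlmostJoined G δ D) (f : Copy M G) {Q : Finset V} (hf : ∀ w, f w ∈ Q)
    (hcard : ∀ j, r * (s * δ) + s ≤ #(commonNbrsIn G (D j) Q)) :
    join M (completeEquipartiteGraph r s) ⊑ G := by
  obtain ⟨D', hsub, hs, hadj⟩ := (hD.mono fun j => commonNbrsIn_subset
    (S := Q)).exists_completelyJoined (s := s) (by simpa using hcard)
  obtain ⟨g, hg⟩ := exists_copy_completeEquipartiteGraph (fun j => (hs j).ge) hadj
  exact ⟨joinCopy f g fun w x => (mem_commonNbrsIn.1 (hsub _ (hg x))).2 _ (hf w)⟩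

end AlmostJoined

section StarForest

variable {V W : Type*} {G : SimpleGraph V} {H : SimpleGraph W} {r s : ℕ}

/-- The disjoint union of `r` stars with `s` leaves each; the vertex `(i, none)` is the centre of
the `i`-th star. In particular, `starForest k 1` is a matching with `k` edges. -/
def starForest (r s : ℕ) : SimpleGraph (Fin r × Option (Fin s)) where
  Adj a b := a.1 = b.1 ∧ (a.2 = none ∧ b.2 ≠ none ∨ a.2 ≠ none ∧ b.2 = none)
  symm := ⟨fun _ _ h => ⟨h.1.symm, h.2.symm.imp And.symm And.symm⟩⟩
  loopless := ⟨fun _ h => by rcases h.2 with h | h <;> tauto⟩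

/-- The copy of a star forest with centres `x i` and leaves `l (i, j)`. -/
def starForestCopy {x : Fin r → V} {l : Fin r × Fin s → V}
    (hinj : Function.Injective (Sum.elim x l)) (hadj : ∀ a, G.Adj (x a.1) (l a)) :
    Copy (starForest r s) G where
  toHom :=
    { toFun := fun a => a.2.elim (x a.1) fun j => l (a.1, j)
      map_rel' := by
        rintro ⟨i, _ | a⟩ ⟨j, _ | b⟩ ⟨hij, h⟩ <;> obtain rfl : i = j := hij
        · simp at h
        · exact hadj (i, b)
        · exact (hadj (i, a)).symm
        · simp at h }
  injective' := by
    have hx := hinj.comp Sum.inl_injective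
    have hl := hinj.comp Sum.inr_injective
    rintro ⟨i, _ | a⟩ ⟨j, _ | b⟩ h
    · exact congrArg (·, none) (hx h)
    · exact absurd (hinj (a₁ := .inl i) (a₂ := .inr (j, b)) h) Sum.inl_ne_inr
    · exact absurd (hinj (a₁ := .inr (i, a)) (a₂ := .inl j) h) Sum.inr_ne_inl
    · exact congrArg (fun c : Fin r × Fin s => (c.1, some c.2)) (hl h)

lemma exists_disjoint_edges_or_cover (G : SimpleGraph V) (k : ℕ) (Y : Finset V) :
    (∃ a b : Fin k → V, Function.Injective (Sum.elim a b) ∧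
      ∀ i, a i ∈ Y ∧ b i ∈ Y ∧ G.Adj (a i) (b i)) ∨
      ∃ C ⊆ Y, #C ≤ 2 * k ∧ G.IsIndepSet ↑(Y \ C) := by
  induction k generalizing Y with
  | zero => exact .inl ⟨Fin.elim0, Fin.elim0, by simp [Function.Injective], fun i => i.elim0⟩
  | succ k ih =>
    by_cases hY : G.IsIndepSet Y
    · exact .inr ⟨∅, by simp, by simp, by simpa using hY⟩
    obtain ⟨u, hu, v, hv, huv⟩ : ∃ u ∈ Y, ∃ v ∈ Y, G.Adj u v := by
      by_contra! h
      exact hY fun u hu v hv _ => h u hu v hv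
    rcases ih (Y \ {u, v}) with ⟨a, b, hinj, hab⟩ | ⟨C, hC, hcard, hind⟩
    · simp only [mem_sdiff, mem_insert, mem_singleton, not_or] at hab
      refine .inl ⟨Fin.cons u a, Fin.cons v b, ?_, Fin.cases ⟨hu, hv, huv⟩ fun i =>
        ⟨(hab i).1.1, (hab i).2.1.1, (hab i).2.2⟩⟩
      rw [Sum.elim_injective] at hinj ⊢
      refine ⟨Fin.cons_injective_iff.2 ⟨fun ⟨i, hi⟩ => (hab i).1.2.1 hi, hinj.1⟩,
        Fin.cons_injective_iff.2 ⟨fun ⟨i, hi⟩ => (hab i).2.1.2.2 hi, hinj.2.1⟩, ?_⟩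
      exact Fin.cases (Fin.cases huv.ne fun j => Ne.symm (hab j).2.1.2.1) fun i =>
        Fin.cases (hab i).1.2.2 fun j => hinj.2.2 i j
    · refine .inr ⟨C ∪ {u, v}, ?_, ?_, ?_⟩
      · exact union_subset (hC.trans sdiff_subset) (by simp [insert_subset_iff, hu, hv])
      · have := card_union_le C {u, v}
        have := card_le_two (a := u) (b := v)
        omega
      · rwa [union_comm, ← sup_eq_union, ← _root_.sdiff_sdiff_left]

lemma exists_matching_or_cover (G : SimpleGraph V) (k : ℕ) (Y : Finset V) :
    (∃ f : Copy (starForest k 1) G, ∀ a, f a ∈ Y) ∨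
      ∃ C ⊆ Y, #C ≤ 2 * k ∧ G.IsIndepSet ↑(Y \ C) := by
  refine (exists_disjoint_edges_or_cover G k Y).imp_left fun ⟨a, b, hinj, hab⟩ => ?_
  have hleaf : Function.Injective (Prod.fst : Fin k × Fin 1 → Fin k) :=
    fun i j hij => Prod.ext hij (Subsingleton.elim _ _)
  rw [Sum.elim_injective] at hinj
  refine ⟨starForestCopy (x := a) (l := b ∘ Prod.fst)
    (hinj.1.sumElim (hinj.2.1.comp hleaf) fun i j => hinj.2.2 i j.1) fun i => (hab i.1).2.2, ?_⟩
  rintro ⟨i, _ | _⟩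
  exacts [(hab i).1, (hab i).2.1]

lemma exists_injective_mem {ι : Type*} [Fintype ι] {A : ι → Finset V}
    (h : ∀ i, Fintype.card ι ≤ #(A i)) : ∃ f : ι → V, Function.Injective f ∧ ∀ i, f i ∈ A i := by
  refine (all_card_le_biUnion_card_iff_exists_injective A).1 fun S => ?_
  rcases S.eq_empty_or_nonempty with rfl | ⟨i, hi⟩
  · simp
  · exact (card_le_univ S).trans ((h i).trans (card_le_card (subset_biUnion_of_mem A hi)))

lemma exists_copy_starForest_sum {X A N : Finset V} (hX : #X = r) (hXN : Disjoint X N)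
    (hA : ∀ x ∈ X, r * s + r + #N ≤ #(nbrsIn G A x)) (g : Copy H G) (hg : ∀ w, g w ∈ N) :
    ∃ f : Copy (starForest r s ⊕g H) G, ∃ B ⊆ A, #B ≤ r * s ∧ ∀ a, f a ∈ X ∪ N ∪ B := by
  let x : Fin r ↪ V := (X.equivFinOfCardEq hX).symm.toEmbedding.trans (.subtype _)
  have hxX : ∀ i, x i ∈ X := fun i => Subtype.prop _
  obtain ⟨l, hl, hlA⟩ := exists_injective_mem (ι := Fin r × Fin s)
      (A := fun i => nbrsIn G A (x i.1) \ (X ∪ N)) fun i => by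
    have := le_card_sdiff (X ∪ N) (nbrsIn G A (x i.1))
    have := hA _ (hxX i.1)
    have := card_union_of_disjoint hXN
    simp only [Fintype.card_prod, Fintype.card_fin]
    omega
  simp only [mem_sdiff, mem_nbrsIn, mem_union, not_or] at hlA
  let f : Copy (starForest r s) G := starForestCopy (x := x) (l := l)
    (x.injective.sumElim hl fun i a h => (hlA a).2.1 (h ▸ hxX i)) fun a => (hlA a).1.2
  have hf : ∀ a, f a ∈ X ∨ f a ∈ univ.image l := by
    rintro ⟨i, _ | j⟩
    exacts [.inl (hxX i), .inr (mem_image_of_mem l (mem_univ (i, j)))]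
  have hfN : ∀ a, f a ∉ N := by
    rintro ⟨i, _ | j⟩
    exacts [disjoint_left.1 hXN (hxX i), (hlA (i, j)).2.2]
  refine ⟨sumCopy f g fun a w h => hfN a (h ▸ hg w), univ.image l, ?_, ?_, ?_⟩
  · exact image_subset_iff.2 fun a _ => (hlA a).1.1
  · simpa using card_image_le (s := univ) (f := l)
  · rintro (a | w)
    · rcases hf a with h | h
      · exact mem_union_left _ (mem_union_left _ h)
      · exact mem_union_right _ h
    · exact mem_union_left _ (mem_union_right _ (hg w))

end StarForest

section Patterns

variable {V : Type*} {G : SimpleGraph V} {W D Z A : Finset V} {a g h : ℕ}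

lemma sum_card_nbrsIn_comm (G : SimpleGraph V) (W D : Finset V) :
    ∑ x ∈ W, #(nbrsIn G D x) = ∑ z ∈ D, #(nbrsIn G W z) := by
  simpa only [nbrsIn, bipartiteAbove, bipartiteBelow, G.adj_comm] using
    sum_card_bipartiteAbove_eq_sum_card_bipartiteBelow (s := W) (t := D) G.Adj

lemma le_two_mul_card_filter_card_nbrsIn (ha : 0 < a) (hW : W.Nonempty)
    (hdeg : ∀ x ∈ W, h ≤ #(nbrsIn G D x)) (hD : #D ≤ a * h) :
    h ≤ 2 * #{z ∈ D | #W ≤ 2 * a * #(nbrsIn G W z)} := by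
  set H := {z ∈ D | #W ≤ 2 * a * #(nbrsIn G W z)}
  have hbound : ∀ z ∈ D, 2 * a * #(nbrsIn G W z) ≤
      #W + if #W ≤ 2 * a * #(nbrsIn G W z) then 2 * a * #W else 0 := fun z _ => by
    split_ifs with hz
    · exact le_add_left (Nat.mul_le_mul_left _ (card_le_card nbrsIn_subset))
    · omega
  have hsum : a * #W * (2 * h) ≤ a * #W * (h + 2 * #H) := calc
    a * #W * (2 * h) = 2 * a * ∑ _ ∈ W, h := by rw [sum_const, smul_eq_mul]; ring
    _ ≤ 2 * a * ∑ x ∈ W, #(nbrsIn G D x) := Nat.mul_le_mul_left _ (sum_le_sum hdeg)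
    _ = ∑ z ∈ D, 2 * a * #(nbrsIn G W z) := by rw [sum_card_nbrsIn_comm, mul_sum]
    _ ≤ #D * #W + #H * (2 * a * #W) := by
      simpa only [sum_add_distrib, sum_const, ← sum_filter, smul_eq_mul] using sum_le_sum hbound
    _ ≤ a * h * #W + #H * (2 * a * #W) := by gcongr
    _ = a * #W * (h + 2 * #H) := by ring
  have := Nat.le_of_mul_le_mul_left hsum (Nat.mul_pos ha hW.card_pos)
  omega

/-- The vertices of `Z` whose adjacency pattern on `W`, that is, whose set of neighbours in `W`, is
`A`. -/
noncomputable def patternClass (G : SimpleGraph V) (W Z A : Finset V) : Finset V :=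
  {z ∈ Z | nbrsIn G W z = A}

lemma patternClass_subset : patternClass G W Z A ⊆ Z := filter_subset _ _

lemma patternClass_subset_commonNbrsIn : patternClass G W Z A ⊆ commonNbrsIn G Z A := fun z hz => by
  obtain ⟨hzZ, rfl⟩ := mem_filter.1 hz
  exact mem_commonNbrsIn.2 ⟨hzZ, fun x hx => (mem_nbrsIn.1 hx).2.symm⟩

lemma exists_patternClass_card_le (hg : 0 < g) (h : 2 ^ #W * g ≤ #Z) :
    ∃ A, (patternClass G W Z A).Nonempty ∧ g ≤ #(patternClass G W Z A) := by
  obtain ⟨A, -, hA⟩ := exists_le_card_fiber_of_mul_le_card_of_maps_to (f := nbrsIn G W)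
    (fun z _ => mem_powerset.2 (nbrsIn_subset (D := W))) ⟨∅, empty_mem_powerset W⟩
    (by rwa [card_powerset])
  exact ⟨A, card_pos.1 (hg.trans_le hA), hA⟩

lemma exists_subset_card_commonNbrsIn (ha : 0 < a) (hg : 0 < g) (hW : W.Nonempty)
    (hdeg : ∀ x ∈ W, h ≤ #(nbrsIn G D x)) (hD : #D ≤ a * h) (hgh : g * 2 ^ (#W + 1) ≤ h) :
    ∃ Q ⊆ W, #W ≤ 2 * a * #Q ∧ g ≤ #(commonNbrsIn G D Q) := by
  have hH := le_two_mul_card_filter_card_nbrsIn ha hW hdeg hD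
  obtain ⟨Q, ⟨z, hz⟩, hQ⟩ := exists_patternClass_card_le (G := G) (W := W)
    (Z := {z ∈ D | #W ≤ 2 * a * #(nbrsIn G W z)}) hg (by rw [pow_succ] at hgh; linarith)
  obtain ⟨hzH, rfl⟩ := mem_filter.1 hz
  refine ⟨_, nbrsIn_subset, (mem_filter.1 hzH).2, hQ.trans (card_le_card ?_)⟩
  exact patternClass_subset_commonNbrsIn.trans (filter_subset_filter _ (filter_subset _ _))

/-- Induction on the number of sets `D i`: each step costs a factor `2 * a` in the size of the
subset. -/
lemma exists_subset_card_forall_commonNbrsIn {ι : Type*} [Fintype ι] {D : ι → Finset V} {b : ℕ}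
    (ha : 0 < a) (hg : 0 < g) (hb : 0 < b) (hdeg : ∀ x ∈ W, ∀ i, h ≤ #(nbrsIn G (D i) x))
    (hD : ∀ i, #(D i) ≤ a * h) (hgh : g * 2 ^ (b * (2 * a) ^ Fintype.card ι + 1) ≤ h)
    (hW : b * (2 * a) ^ Fintype.card ι ≤ #W) :
    ∃ Q ⊆ W, #Q = b ∧ ∀ i, g ≤ #(commonNbrsIn G (D i) Q) := by
  suffices ∀ S : Finset ι, ∃ Q ⊆ W, #Q = b * (2 * a) ^ (Fintype.card ι - #S) ∧
      ∀ i ∈ S, g ≤ #(commonNbrsIn G (D i) Q) by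
    simpa using this univ
  intro S
  induction S using Finset.induction_on with
  | empty =>
    obtain ⟨Q, hQ, hc⟩ := exists_subset_card_eq hW
    exact ⟨Q, hQ, by simpa using hc, by simp⟩
  | insert i S hi ih =>
    obtain ⟨Q, hQW, hQ, hS⟩ := ih
    have hcard : #S + 1 ≤ Fintype.card ι := card_insert_of_notMem hi ▸ card_le_univ _
    have hpow : #Q ≤ b * (2 * a) ^ Fintype.card ι :=
      hQ.trans_le (Nat.mul_le_mul_left _ (Nat.pow_le_pow_right (by omega) (Nat.sub_le _ _)))
    obtain ⟨Q₁, hQ₁, hQ₁card, hcommon⟩ := exists_subset_card_commonNbrsIn ha hg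
      (card_pos.1 (hQ ▸ by positivity)) (fun x hx => hdeg x (hQW hx) i) (hD i)
      ((Nat.mul_le_mul_left g (Nat.pow_le_pow_right two_pos (Nat.succ_le_succ hpow))).trans hgh)
    have hle : b * (2 * a) ^ (Fintype.card ι - #(insert i S)) ≤ #Q₁ := by
      rw [hQ, show Fintype.card ι - #S = (Fintype.card ι - (#S + 1)) + 1 by omega, pow_succ,
        ← mul_assoc, mul_comm _ (2 * a)] at hQ₁card
      rw [card_insert_of_notMem hi]
      exact Nat.le_of_mul_le_mul_left hQ₁card (by positivity)
    obtain ⟨Q₂, hQ₂, hQ₂card⟩ := exists_subset_card_eq hle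
    refine ⟨Q₂, hQ₂.trans (hQ₁.trans hQW), hQ₂card, fun j hj => ?_⟩
    rcases mem_insert.1 hj with rfl | hj
    · exact hcommon.trans (card_le_card (commonNbrsIn_anti hQ₂))
    · exact (hS j hj).trans (card_le_card (commonNbrsIn_anti (hQ₂.trans hQ₁)))

end Patterns

section StarForestCopies

variable {V X : Type*} {G : SimpleGraph V} {H : SimpleGraph X} {m r s k l δ : ℕ}

lemma AlmostJoined.starForest_sum_isContained {P : Fin (m + 1) → Finset V}
    (hP : AlmostJoined G δ P) (i₀ : Fin (m + 1)) {Q N : Finset V} (hQ : #Q = r)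
    (hQN : Disjoint Q N) (g : Copy H G) (hg : ∀ w, g w ∈ N)
    (hleaf : ∀ x ∈ Q, r * l + r + #N ≤ #(nbrsIn G (P i₀) x))
    (hcommon : ∀ j ≠ i₀, m * (s * δ) + s + r * l * δ ≤ #(commonNbrsIn G (P j) (Q ∪ N))) :
    join (starForest r l ⊕g H) (completeEquipartiteGraph m s) ⊑ G := by
  obtain ⟨f, B, hBP, hB, hf⟩ := exists_copy_starForest_sum hQ hQN hleaf g hg
  refine (hP.comp_injective (Fin.succAbove_right_injective (p := i₀))).join_isContained f hf
    fun j => ?_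
  have hmiss := card_commonNbrsIn_le_card_union_add (S := Q ∪ N)
    fun u hu => hP (Fin.succAbove_ne i₀ j).symm u (hBP hu)
  have hcard := hcommon _ (Fin.succAbove_ne i₀ j)
  have := Nat.mul_le_mul_right δ hB
  rw [Function.comp_apply]
  omega

lemma AlmostJoined.starForest_edge_isContained {P : Fin (m + 1) → Finset V}
    (hP : AlmostJoined G δ P) (i₀ : Fin (m + 1)) {Q : Finset V} (hQ : #Q = r + 1)
    (hleaf : ∀ x ∈ Q, r * s + r + 2 ≤ #(nbrsIn G (P i₀) x))
    (hcommon : ∀ j ≠ i₀, m * (s * δ) + s + r * s * δ + δ ≤ #(commonNbrsIn G (P j) Q)) :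
    join (starForest r s ⊕g (⊤ : SimpleGraph (Fin 2))) (completeEquipartiteGraph m s) ⊑ G := by
  obtain ⟨y, hy⟩ : Q.Nonempty := card_pos.1 (by omega)
  have hQy : #(Q.erase y) = r := by rw [card_erase_of_mem hy, hQ, Nat.add_sub_cancel]
  obtain ⟨z, hz, hzQ⟩ : ∃ z ∈ nbrsIn G (P i₀) y, z ∉ Q.erase y := by
    by_contra! h
    have := card_le_card h
    have := hleaf y hy
    omega
  obtain ⟨hzP, hyz⟩ := mem_nbrsIn.1 hz
  have hpair : #({y, z} : Finset V) = 2 := card_pair hyz.ne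
  refine hP.starForest_sum_isContained i₀ hQy (N := {y, z}) ?_ (edgeCopy hyz) (edgeCopy_mem hyz)
    (fun x hx => by rw [hpair]; exact hleaf x (mem_of_mem_erase hx)) fun j hj => ?_
  · simp only [disjoint_insert_right, disjoint_singleton_right]
    exact ⟨notMem_erase y Q, hzQ⟩
  · have hmiss := card_commonNbrsIn_le_card_union_add (G := G) (D := P j) (S := Q) (T := {z})
      (l := δ) (by simpa using hP hj.symm z hzP)
    have hset : Q.erase y ∪ {y, z} = Q ∪ {z} := by
      rw [← insert_erase hy]
      ext
      simp
    have := hcommon j hj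
    rw [card_singleton, one_mul] at hmiss
    rw [hset]
    omega

lemma AlmostJoined.exists_isIndepSet_sdiff {D : Fin m → Finset V} (hD : AlmostJoined G δ D)
    (hfree : (join (starForest k 1) (completeEquipartiteGraph m s)).Free G) {Y : Finset V}
    (hY : ∀ j, ∀ y ∈ Y, #(nonNbrsIn G (D j) y) ≤ l)
    (hcard : ∀ j, m * (s * δ) + s + 2 * k * l ≤ #(D j)) :
    ∃ C ⊆ Y, #C ≤ 2 * k ∧ G.IsIndepSet ↑(Y \ C) := by
  refine (exists_matching_or_cover G k Y).resolve_left fun ⟨f, hf⟩ => hfree ?_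
  refine hD.join_isContained f (fun w => mem_image_of_mem f (mem_univ w)) fun j => ?_
  have himage : #(univ.image f) ≤ 2 * k := card_image_le.trans (by simp [mul_comm])
  have hmiss : #(D j) ≤ #(commonNbrsIn G (D j) (univ.image f)) + #(univ.image f) * l :=
    card_le_card_commonNbrsIn_add fun u hu => by
      obtain ⟨w, -, rfl⟩ := mem_image.1 hu
      exact hY j _ (hf w)
  have := Nat.mul_le_mul_right l himage
  have := hcard j
  omega

end StarForestCopies

section ExceptionalVertices

variable {V ι : Type*} [Fintype V] {G : SimpleGraph V} {m r s h g δ : ℕ}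

/-- The vertices with fewer than `h` neighbours in `D`. If `D` is a class of a graph that is close
to a Turán graph, then these are the vertices that behave like elements of `D`. -/
noncomputable def sparseTo (G : SimpleGraph V) (D : Finset V) (h : ℕ) : Finset V :=
  {x | #(nbrsIn G D x) < h}

/-- The vertices with at least `h` neighbours in each of the sets `P i`. -/
noncomputable def exceptional (G : SimpleGraph V) (P : ι → Finset V) (h : ℕ) : Finset V :=
  {x | ∀ i, h ≤ #(nbrsIn G (P i) x)}

@[simp] lemma mem_sparseTo {D : Finset V} {x : V} : x ∈ sparseTo G D h ↔ #(nbrsIn G D x) < h := by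
  simp [sparseTo]

@[simp] lemma mem_exceptional {P : ι → Finset V} {x : V} :
    x ∈ exceptional G P h ↔ ∀ i, h ≤ #(nbrsIn G (P i) x) := by
  simp [exceptional]

lemma exists_mem_sparseTo {P : ι → Finset V} {x : V} (hx : x ∉ exceptional G P h) :
    ∃ i, x ∈ sparseTo G (P i) h := by
  simpa using hx

lemma subset_sparseTo {D : Finset V} (hD : G.IsIndepSet D) (hh : 0 < h) : D ⊆ sparseTo G D h := by
  intro x hx
  rw [mem_sparseTo, nbrsIn, filter_false_of_mem fun v hv hxv => hD hx hv hxv.ne hxv]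
  simpa using hh

lemma AlmostJoined.card_exceptional_lt {P : Fin (m + 1) → Finset V} (hP : AlmostJoined G δ P)
    (hfree : (join (starForest r s ⊕g (⊤ : SimpleGraph (Fin 2)))
      (completeEquipartiteGraph m s)).Free G)
    {a : ℕ} (ha : 0 < a) (hg : 0 < g) (hsize : ∀ i, #(P i) ≤ a * h)
    (hgh : g * 2 ^ ((r + 1) * (2 * a) ^ (m + 1) + 1) ≤ h)
    (hleaf : r * s + r + 2 ≤ h) (hcommon : m * (s * δ) + s + r * s * δ + δ ≤ g) :
    #(exceptional G P h) < (r + 1) * (2 * a) ^ (m + 1) := by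
  by_contra! hlt
  obtain ⟨Q, hQ, hQcard, hQcommon⟩ := exists_subset_card_forall_commonNbrsIn (D := P) ha hg
    (Nat.succ_pos r) (fun x hx => mem_exceptional.1 hx) hsize (by simpa using hgh)
    (by simpa using hlt)
  exact hfree (hP.starForest_edge_isContained 0 hQcard
    (fun x hx => hleaf.trans (mem_exceptional.1 (hQ hx) 0)) fun j _ => hcommon.trans (hQcommon j))

end ExceptionalVertices

section NearPartition

variable {V : Type*} [Fintype V] {G : SimpleGraph V} {m s k h δ : ℕ}

/-- Disjoint independent sets `P i` of almost equal size that cover almost all vertices and that are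
almost completely joined to each other. -/
structure NearPartition (G : SimpleGraph V) (p δ : ℕ) (P : Fin p → Finset V) : Prop where
  indep : ∀ i, G.IsIndepSet (P i)
  disj : Pairwise fun i j => Disjoint (P i) (P j)
  almostJoined : AlmostJoined G δ P
  size : ∀ i, Fintype.card V ≤ p * #(P i) + p * δ

lemma card_nbrsIn_univ (G : SimpleGraph V) (v : V) : #(nbrsIn G univ v) = G.degree v := by
  rw [← G.card_neighborFinset_eq_degree, G.neighborFinset_eq_filter, nbrsIn]

lemma mul_card_nonNbrsIn_univ_le {v : V} (hv : m * Fintype.card V ≤ (m + 1) * (G.degree v + 1)) :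
    (m + 1) * #(nonNbrsIn G univ v) ≤ Fintype.card V + (m + 1) := by
  have hsum := congrArg ((m + 1) * ·) (card_nbrsIn_add_card_nonNbrsIn G univ v)
  simp only [card_nbrsIn_univ, card_univ, mul_add, add_mul, one_mul, mul_one] at hsum hv ⊢
  omega

lemma mul_card_le_of_isIndepSet (hdeg : ∀ v, m * Fintype.card V ≤ (m + 1) * (G.degree v + 1))
    {D : Finset V} (hD : G.IsIndepSet D) : (m + 1) * #D ≤ Fintype.card V + (m + 1) := by
  rcases D.eq_empty_or_nonempty with rfl | ⟨v, hv⟩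
  · simp
  · refine (Nat.mul_le_mul_left _ (card_le_card fun u hu => ?_)).trans
      (mul_card_nonNbrsIn_univ_le (hdeg v))
    exact mem_nonNbrsIn.2 ⟨mem_univ u, fun huv => hD hv hu huv.ne huv⟩

variable {P : Fin (m + 1) → Finset V}

lemma NearPartition.card_nonNbrsIn_le (hP : NearPartition G (m + 1) δ P) {x : V}
    (hdeg : m * Fintype.card V ≤ (m + 1) * (G.degree x + 1)) {i j : Fin (m + 1)} (hij : i ≠ j)
    (hx : x ∈ sparseTo G (P i) h) : #(nonNbrsIn G (P j) x) ≤ h + δ := by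
  have hunion : #(nonNbrsIn G (P i) x) + #(nonNbrsIn G (P j) x) ≤ #(nonNbrsIn G univ x) := by
    rw [← card_union_of_disjoint (s := nonNbrsIn G (P i) x) (t := nonNbrsIn G (P j) x)
      (disjoint_filter_filter (hP.disj hij))]
    exact card_le_card
      (union_subset (nonNbrsIn_mono (subset_univ _)) (nonNbrsIn_mono (subset_univ _)))
  have hi := card_nbrsIn_add_card_nonNbrsIn G (P i) x
  rw [mem_sparseTo] at hx
  have hle : (m + 1) * (#(P i) + #(nonNbrsIn G (P j) x) + 1) ≤
      (m + 1) * (#(P i) + δ + 1 + h) := calc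
    _ ≤ (m + 1) * (#(nonNbrsIn G univ x) + h) := Nat.mul_le_mul_left _ (by omega)
    _ ≤ Fintype.card V + (m + 1) + (m + 1) * h := by
      rw [mul_add]
      exact Nat.add_le_add_right (mul_card_nonNbrsIn_univ_le hdeg) _
    _ ≤ (m + 1) * #(P i) + (m + 1) * δ + (m + 1) + (m + 1) * h := by gcongr; exact hP.size i
    _ = (m + 1) * (#(P i) + δ + 1 + h) := by ring
  have := Nat.le_of_mul_le_mul_left hle m.succ_pos
  omega

lemma NearPartition.exists_core (hP : NearPartition G (m + 1) δ P)
    (hdeg : ∀ v, m * Fintype.card V ≤ (m + 1) * (G.degree v + 1))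
    (hmatch : (join (starForest k 1) (completeEquipartiteGraph m s)).Free G) (hh : 0 < h)
    (hsize : ∀ j, m * (s * δ) + s + 2 * k * (h + δ) ≤ #(P j)) (i : Fin (m + 1)) :
    ∃ Z ⊆ P i, (∀ z ∈ Z, ∀ y ∈ sparseTo G (P i) h, ¬ G.Adj z y) ∧
      #(P i) ≤ #Z + 2 * k * (h + 1) := by
  obtain ⟨C, hCY, hC, hind⟩ := (hP.almostJoined.comp_injective
    (Fin.succAbove_right_injective (p := i))).exists_isIndepSet_sdiff hmatch
      (Y := sparseTo G (P i) h)
      (fun j y hy => hP.card_nonNbrsIn_le (hdeg y) (Fin.succAbove_ne i j).symm hy)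
      fun j => hsize _
  refine ⟨(P i \ C) \ C.biUnion (nbrsIn G (P i)), sdiff_subset.trans sdiff_subset,
    fun z hz y hy hzy => ?_, ?_⟩
  · simp only [mem_sdiff, mem_biUnion, mem_nbrsIn, not_exists, not_and] at hz
    by_cases hyC : y ∈ C
    · exact hz.2 y hyC hz.1.1 hzy.symm
    · exact hind (by simpa using ⟨mem_sparseTo.1 (subset_sparseTo (hP.indep i) hh hz.1.1), hz.1.2⟩)
        (by simpa using ⟨mem_sparseTo.1 hy, hyC⟩) hzy.ne hzy
  · have hN : #(C.biUnion (nbrsIn G (P i))) ≤ 2 * k * h :=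
      (card_biUnion_le_card_mul _ _ _ fun c hc => (mem_sparseTo.1 (hCY hc)).le).trans
        (Nat.mul_le_mul_right _ hC)
    have := le_card_sdiff (C.biUnion (nbrsIn G (P i))) (P i \ C)
    have := le_card_sdiff C (P i)
    rw [mul_add_one]
    omega

end NearPartition

section PopularPatterns

variable {V : Type*} {G : SimpleGraph V} {m r s g h δ : ℕ} {W : Finset V}

lemma eq_of_sum_card_of_card_inter {A : Fin (m + 1) → Finset V} (hAW : ∀ i, A i ⊆ W)
    (hsum : m * #W + r ≤ ∑ i, #(A i)) (hinter : ∀ i₀, #{x ∈ W | ∀ i ≠ i₀, x ∈ A i} ≤ r) :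
    #W = r ∧ ∀ i, A i = W := by
  have hcompl : ∑ i, #(W \ A i) + ∑ i, #(A i) = (m + 1) * #W := by
    rw [← sum_add_distrib, sum_congr rfl fun i _ => card_sdiff_add_card_eq_card (hAW i)]
    simp
  have hWle : ∀ i₀, #W ≤ r + ∑ i ∈ univ.erase i₀, #(W \ A i) := fun i₀ => by
    have hcover : W ⊆ {x ∈ W | ∀ i ≠ i₀, x ∈ A i} ∪ (univ.erase i₀).biUnion (W \ A ·) := by
      intro x hx
      by_cases h : ∀ i ≠ i₀, x ∈ A i
      · exact mem_union_left _ (mem_filter.2 ⟨hx, h⟩)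
      · push Not at h
        obtain ⟨i, hi, hxi⟩ := h
        exact mem_union_right _ (mem_biUnion.2
          ⟨i, mem_erase.2 ⟨hi, mem_univ _⟩, mem_sdiff.2 ⟨hx, hxi⟩⟩)
    exact (card_le_card hcover).trans ((card_union_le _ _).trans
      (Nat.add_le_add (hinter i₀) card_biUnion_le))
  have hempty : ∀ i₀, #(W \ A i₀) = 0 := fun i₀ => by
    have := add_sum_erase univ (fun i => #(W \ A i)) (mem_univ i₀)
    have := hWle i₀
    rw [add_mul, one_mul] at hcompl
    omega
  refine ⟨?_, fun i => (hAW i).antisymm (sdiff_eq_empty_iff_subset.1 (card_eq_zero.1 (hempty i)))⟩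
  have := hWle 0
  simp only [hempty, sum_const_zero, add_mul, one_mul] at this hcompl
  omega

lemma sum_degree_le_of_exists_not_adj [Fintype V] {z : Fin (m + 1) → V}
    (hz : ∀ u ∉ W, ∃ i, ¬ G.Adj (z i) u) :
    ∑ i, G.degree (z i) ≤ ∑ i, #(nbrsIn G W (z i)) + m * #Wᶜ := by
  have hsplit : ∀ v, G.degree v = #(nbrsIn G W v) + #(nbrsIn G Wᶜ v) := fun v => by
    rw [← card_nbrsIn_univ, ← union_compl W, nbrsIn, filter_union, card_union_of_disjoint
      (disjoint_filter_filter disjoint_compl_right)]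
    rfl
  have hmiss : ∀ u ∈ Wᶜ, #{i | G.Adj (z i) u} ≤ m := fun u hu => by
    obtain ⟨i, hi⟩ := hz u (mem_compl.1 hu)
    have hsub : ({j | G.Adj (z j) u} : Finset (Fin (m + 1))) ⊆ univ.erase i := fun j hj =>
      mem_erase.2 ⟨by rintro rfl; exact hi (mem_filter.1 hj).2, mem_univ j⟩
    simpa using card_le_card hsub
  calc ∑ i, G.degree (z i) = ∑ i, #(nbrsIn G W (z i)) + ∑ i, #(nbrsIn G Wᶜ (z i)) := by
        rw [← sum_add_distrib, sum_congr rfl fun i _ => hsplit (z i)]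
    _ = ∑ i, #(nbrsIn G W (z i)) + ∑ u ∈ Wᶜ, #{i | G.Adj (z i) u} := by
        congr 1
        exact sum_card_bipartiteAbove_eq_sum_card_bipartiteBelow fun i u => G.Adj (z i) u
    _ ≤ ∑ i, #(nbrsIn G W (z i)) + m * #Wᶜ := by
        rw [mul_comm]
        exact Nat.add_le_add_left (sum_le_card_nsmul _ _ _ hmiss) _

/-- Representatives of the pattern classes form a clique, which misses a vertex in the
neighbourhood of each vertex outside `W`. -/
lemma AlmostJoined.le_sum_card_pattern [Fintype V] {Z : Fin (m + 1) → Finset V}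
    (hZ : AlmostJoined G δ Z)
    (hclique : ∀ S, G.IsNClique (m + 1) S → m * Fintype.card V + r ≤ ∑ v ∈ S, G.degree v)
    (hW : ∀ u ∉ W, ∃ i, ∀ z ∈ Z i, ¬ G.Adj z u) {A : Fin (m + 1) → Finset V}
    (hA : ∀ i, (m + 1) * δ + 1 ≤ #(patternClass G W (Z i) (A i))) :
    m * #W + r ≤ ∑ i, #(A i) := by
  obtain ⟨D, hD, hD1, hadj⟩ := (hZ.mono fun i => patternClass_subset (A := A i)
    (W := W)).exists_completelyJoined (s := 1) (by simpa using hA)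
  choose z hz using fun i => card_eq_one.1 (hD1 i)
  have hzD : ∀ i, z i ∈ D i := fun i => by simp [hz i]
  have hzA : ∀ i, z i ∈ Z i ∧ nbrsIn G W (z i) = A i := fun i => mem_filter.1 (hD i (hzD i))
  have hzadj : Pairwise fun i j => G.Adj (z i) (z j) :=
    fun i j hij => hadj hij _ (hzD i) _ (hzD j)
  have hinj : Function.Injective z := fun i j hij => by
    by_contra hne
    exact (hzadj hne).ne hij
  have hle := hclique (univ.map ⟨z, hinj⟩) ⟨by
    simp only [coe_map, Function.Embedding.coeFn_mk, coe_univ, Set.image_univ]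
    rintro _ ⟨i, rfl⟩ _ ⟨j, rfl⟩ hij
    exact hzadj (ne_of_apply_ne z hij), by simp⟩
  have hsum := sum_degree_le_of_exists_not_adj (G := G) (W := W) (z := z) fun u hu =>
    (hW u hu).imp fun i hi => hi _ (hzA i).1
  simp only [sum_map, Function.Embedding.coeFn_mk, (hzA _).2, ← card_add_card_compl W,
    mul_add] at hle hsum
  omega

lemma AlmostJoined.card_inter_pattern_le {P : Fin (m + 1) → Finset V} (hP : AlmostJoined G δ P)
    (hfree : (join (starForest r s ⊕g (⊤ : SimpleGraph (Fin 2)))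
      (completeEquipartiteGraph m s)).Free G)
    {A : Fin (m + 1) → Finset V} {i₀ : Fin (m + 1)}
    (hW : ∀ x ∈ W, r * s + r + 2 ≤ #(nbrsIn G (P i₀) x))
    (hA : ∀ i, m * (s * δ) + s + r * s * δ + δ ≤ #(patternClass G W (P i) (A i))) :
    #{x ∈ W | ∀ i ≠ i₀, x ∈ A i} ≤ r := by
  by_contra! hlt
  obtain ⟨Q, hQ, hQr⟩ := exists_subset_card_eq hlt
  refine hfree (hP.starForest_edge_isContained i₀ hQr (fun x hx => hW x (mem_filter.1 (hQ hx)).1)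
    fun j hj => ?_)
  exact (hA j).trans (card_le_card (patternClass_subset_commonNbrsIn.trans
    (commonNbrsIn_anti fun x hx => (mem_filter.1 (hQ hx)).2 j hj)))

lemma card_lt_card_patternClass_add {ι : Type*} {Z : ι → Finset V}
    (hpopular : ∀ A : ι → Finset V, (∀ i, g ≤ #(patternClass G W (Z i) (A i))) → ∀ i, A i = W)
    (hg : 0 < g) (hgh : 2 ^ #W * g ≤ h) (hZ : ∀ i, h ≤ #(Z i)) (i : ι) :
    #(Z i) < #(patternClass G W (Z i) W) + h := by
  by_contra! hle
  obtain ⟨A, ⟨z, hz⟩, hA⟩ := exists_patternClass_card_le (G := G) (W := W)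
    (Z := {z ∈ Z i | ¬ nbrsIn G W z = W}) hg (hgh.trans (by
      have := card_filter_add_card_filter_not (s := Z i) (nbrsIn G W · = W)
      rw [patternClass] at hle
      omega))
  choose B hB using fun j => (exists_patternClass_card_le (G := G) hg (hgh.trans (hZ j))).imp
    fun _ => And.right
  have hAW := hpopular (Function.update B i A) (fun j => by
    by_cases hj : j = i
    · subst hj
      rw [Function.update_self]
      exact hA.trans (card_le_card (filter_subset_filter _ (filter_subset _ _)))
    · rw [Function.update_of_ne hj]
      exact hB j) i
  rw [Function.update_self] at hAW
  obtain ⟨hzZ, hzA⟩ := mem_filter.1 hz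
  exact (mem_filter.1 hzZ).2 (hzA.trans hAW)

end PopularPatterns

section Structure

variable {V : Type*} [Fintype V] {G : SimpleGraph V} {m r s k h g δ : ℕ}
  {P : Fin (m + 1) → Finset V}

/-- The degree conditions of a graph whose number of edges cannot be pushed further above that of
`H'(n, m + 1, r + 1)` by deleting vertices: deleting a single vertex is ruled out by a lower bound
on its degree, and deleting a clique with one vertex in each of the `m + 1` classes by a lower bound
on its degree sum, which also accounts for the `r` additional vertices. -/
structure TuranDegrees (G : SimpleGraph V) (m r : ℕ) : Prop where
  degree : ∀ v, m * Fintype.card V ≤ (m + 1) * (G.degree v + 1)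
  clique : ∀ S, G.IsNClique (m + 1) S → m * Fintype.card V + r ≤ ∑ v ∈ S, G.degree v

/-- An edge inside a class would extend the stars centred at the exceptional vertices to a copy of
a star forest with an additional edge. -/
lemma NearPartition.not_adj_of_mem_sparseTo (hP : NearPartition G (m + 1) δ P)
    (hdeg : ∀ v, m * Fintype.card V ≤ (m + 1) * (G.degree v + 1))
    (hstar : (join (starForest r s ⊕g (⊤ : SimpleGraph (Fin 2)))
      (completeEquipartiteGraph m s)).Free G)
    {W : Finset V} (hW : #W = r) {i : Fin (m + 1)}
    (hleaf : ∀ x ∈ W, r * s + r + 2 ≤ #(nbrsIn G (P i) x))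
    (hcommon : ∀ j, m * (s * δ) + s + r * s * δ + 2 * (h + δ) ≤ #(commonNbrsIn G (P j) W))
    {u v : V} (hu : u ∈ sparseTo G (P i) h \ W) (hv : v ∈ sparseTo G (P i) h \ W) :
    ¬ G.Adj u v := by
  intro huv
  rw [mem_sdiff] at hu hv
  have hpair : #({u, v} : Finset V) = 2 := card_pair huv.ne
  refine hstar (hP.almostJoined.starForest_sum_isContained i hW (N := {u, v})
    (by simp [hu.2, hv.2]) (edgeCopy huv) (edgeCopy_mem huv) (by simpa only [hpair] using hleaf)
    fun j hj => ?_)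
  have hmiss := card_commonNbrsIn_le_card_union_add (G := G) (D := P j) (S := W) (T := {u, v})
    (l := h + δ) (by
      simp only [mem_insert, mem_singleton, forall_eq_or_imp, forall_eq]
      exact ⟨hP.card_nonNbrsIn_le (hdeg u) hj.symm hu.1,
        hP.card_nonNbrsIn_le (hdeg v) hj.symm hv.1⟩)
  have := hcommon j
  rw [hpair] at hmiss
  omega

lemma NearPartition.colorable_induce_compl_exceptional (hP : NearPartition G (m + 1) δ P)
    (hdeg : ∀ v, m * Fintype.card V ≤ (m + 1) * (G.degree v + 1))
    (hstar : (join (starForest r s ⊕g (⊤ : SimpleGraph (Fin 2)))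
      (completeEquipartiteGraph m s)).Free G)
    (hW : #(exceptional G P h) = r) (hh : r * s + r + 2 ≤ h)
    (hcommon : ∀ j, m * (s * δ) + s + r * s * δ + 2 * (h + δ) ≤
      #(commonNbrsIn G (P j) (exceptional G P h))) :
    (G.induce (exceptional G P h : Set V)ᶜ).Colorable (m + 1) := by
  have hclass : ∀ v : ↑(exceptional G P h : Set V)ᶜ, ∃ i,
      (v : V) ∈ sparseTo G (P i) h \ exceptional G P h := fun v => by
    have hv : (v : V) ∉ exceptional G P h := mt mem_coe.2 v.2
    exact (exists_mem_sparseTo hv).imp fun i hi => mem_sdiff.2 ⟨hi, hv⟩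
  choose c hc using hclass
  refine ⟨Coloring.mk c fun {u v} huv hcuv => ?_⟩
  exact hP.not_adj_of_mem_sparseTo hdeg hstar hW
    (fun x hx => hh.trans (mem_exceptional.1 hx (c u))) hcommon (hc u) (hcuv ▸ hc v) huv

lemma AlmostJoined.exceptional_pattern_eq (hP : AlmostJoined G δ P)
    (hclique : ∀ S, G.IsNClique (m + 1) S → m * Fintype.card V + r ≤ ∑ v ∈ S, G.degree v)
    (hstar : (join (starForest r s ⊕g (⊤ : SimpleGraph (Fin 2)))
      (completeEquipartiteGraph m s)).Free G)
    {Z : Fin (m + 1) → Finset V} (hZP : ∀ i, Z i ⊆ P i)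
    (hZ : ∀ i, ∀ z ∈ Z i, ∀ y ∈ sparseTo G (P i) h, ¬ G.Adj z y)
    (hh : r * s + r + 2 ≤ h) (hg : m * (s * δ) + s + r * s * δ + (m + 1) * δ + 1 ≤ g)
    {A : Fin (m + 1) → Finset V}
    (hA : ∀ i, g ≤ #(patternClass G (exceptional G P h) (Z i) (A i))) :
    #(exceptional G P h) = r ∧ ∀ i, A i = exceptional G P h := by
  have hδ : δ ≤ (m + 1) * δ := Nat.le_mul_of_pos_left _ m.succ_pos
  refine eq_of_sum_card_of_card_inter (fun i => ?_) ?_ fun i₀ => ?_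
  · obtain ⟨z, hz⟩ := card_pos.1 (show 0 < #(patternClass G (exceptional G P h) (Z i) (A i)) by
      have := hA i
      omega)
    obtain ⟨-, hzA⟩ := mem_filter.1 hz
    exact hzA ▸ nbrsIn_subset
  · refine (hP.mono hZP).le_sum_card_pattern hclique (fun u hu => ?_) fun i =>
      le_trans (by omega) (hA i)
    exact (exists_mem_sparseTo hu).imp fun i hi z hz => hZ i z hz u hi
  · refine hP.card_inter_pattern_le hstar (fun x hx => hh.trans (mem_exceptional.1 hx i₀))
      fun i => ?_
    have hle : g ≤ #(patternClass G (exceptional G P h) (P i) (A i)) :=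
      (hA i).trans (card_le_card (filter_subset_filter _ (hZP i)))
    omega

lemma NearPartition.card_exceptional_eq (hP : NearPartition G (m + 1) δ P) (hG : TuranDegrees G m r)
    (hmatch : (join (starForest k 1) (completeEquipartiteGraph m s)).Free G)
    (hstar : (join (starForest r s ⊕g (⊤ : SimpleGraph (Fin 2)))
      (completeEquipartiteGraph m s)).Free G)
    {a : ℕ} (ha : 0 < a) (hsize : ∀ i, #(P i) ≤ a * h)
    (hgh : g * 2 ^ ((r + 1) * (2 * a) ^ (m + 1) + 1) ≤ h)
    (hg : m * (s * δ) + s + r * s * δ + (m + 1) * δ + r * s + r + 2 ≤ g)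
    (hcard : ∀ i, m * (s * δ) + s + 2 * k * (h + δ + 1) + h ≤ #(P i)) :
    #(exceptional G P h) = r ∧
      ∀ i, #(P i) ≤ #(commonNbrsIn G (P i) (exceptional G P h)) + 2 * k * (h + 1) + h := by
  have hδ : δ ≤ (m + 1) * δ := Nat.le_mul_of_pos_left _ m.succ_pos
  have hgle : g ≤ h := (Nat.le_mul_of_pos_right _ (by positivity)).trans hgh
  have hk : 2 * k * (h + 1) ≤ 2 * k * (h + δ + 1) := Nat.mul_le_mul_left _ (by omega)
  have hk' : 2 * k * (h + δ) ≤ 2 * k * (h + δ + 1) := Nat.mul_le_mul_left _ (by omega)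
  choose Z hZP hZ hZcard using fun i => hP.exists_core hG.degree hmatch (h := h) (by omega)
    (fun j => le_trans (by omega) (hcard j)) i
  have hpopular := fun A => hP.almostJoined.exceptional_pattern_eq (A := A) hG.clique hstar hZP hZ
    (by omega) (show _ ≤ g by omega)
  have hpow : 2 ^ #(exceptional G P h) * g ≤ h := by
    rw [mul_comm]
    refine (Nat.mul_le_mul_left _ (Nat.pow_le_pow_right two_pos ?_)).trans hgh
    exact (hP.almostJoined.card_exceptional_lt hstar ha (by omega) hsize hgh (by omega)
      (by omega)).le.trans (Nat.le_succ _)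
  have hZh : ∀ i, h ≤ #(Z i) := fun i => by
    have := hcard i
    have := hZcard i
    omega
  choose B hB using fun i => (exists_patternClass_card_le (G := G) (show 0 < g by omega)
    (hpow.trans (hZh i))).imp fun _ => And.right
  refine ⟨(hpopular B hB).1, fun i => ?_⟩
  have hlt := card_lt_card_patternClass_add (fun A hA => (hpopular A hA).2) (by omega) hpow hZh i
  have hle := card_le_card (patternClass_subset_commonNbrsIn (G := G) (W := exceptional G P h)
    (Z := Z i) (A := exceptional G P h))
  have hmono := card_le_card
    (commonNbrsIn_mono (G := G) (S := exceptional G P h) (hZP i))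
  have := hZcard i
  omega

theorem NearPartition.exists_structure (hP : NearPartition G (m + 1) δ P) (hG : TuranDegrees G m r)
    (hmatch : (join (starForest k 1) (completeEquipartiteGraph m s)).Free G)
    (hstar : (join (starForest r s ⊕g (⊤ : SimpleGraph (Fin 2)))
      (completeEquipartiteGraph m s)).Free G)
    (h_le : 8 * (m + 1) * (k + 1) * h ≤ Fintype.card V)
    (le_h : Fintype.card V ≤ 16 * (m + 1) * (k + 1) * h)
    (hgh : g * 2 ^ ((r + 1) * (2 * (17 * (k + 1))) ^ (m + 1) + 1) ≤ h)
    (hg : (m + 1) * (s * δ) + s + r * s * δ + (m + 1) * δ + r * s + r + 2 * (k * δ) + 2 * k + 2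
      ≤ g) :
    ∃ X : Finset V, #X = r ∧ (G.induce (X : Set V)ᶜ).Colorable (m + 1) ∧
      join (G.induce (X : Set V)) (completeEquipartiteGraph (m + 1) s) ⊑ G := by
  have hgle : g ≤ h := (Nat.le_mul_of_pos_right _ (by positivity)).trans hgh
  have hlow : ∀ i, 8 * (k * h) + 8 * h ≤ #(P i) + δ := fun i => by
    refine Nat.le_of_mul_le_mul_left (?_ : (m + 1) * _ ≤ (m + 1) * _) m.succ_pos
    calc (m + 1) * (8 * (k * h) + 8 * h) = 8 * (m + 1) * (k + 1) * h := by ring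
      _ ≤ (m + 1) * #(P i) + (m + 1) * δ := h_le.trans (hP.size i)
      _ = (m + 1) * (#(P i) + δ) := by ring
  have hup : ∀ i, #(P i) ≤ 17 * (k + 1) * h := fun i => by
    refine Nat.le_of_mul_le_mul_left (?_ : (m + 1) * _ ≤ (m + 1) * _) m.succ_pos
    calc (m + 1) * #(P i) ≤ 16 * (m + 1) * (k + 1) * h + (m + 1) * 1 :=
          (mul_card_le_of_isIndepSet hG.degree (hP.indep i)).trans (by omega)
      _ ≤ 16 * (m + 1) * (k + 1) * h + (m + 1) * ((k + 1) * h) := by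
          gcongr
          exact Nat.mul_pos k.succ_pos (by omega)
      _ = (m + 1) * (17 * (k + 1) * h) := by ring
  have hδ : δ ≤ (m + 1) * δ := Nat.le_mul_of_pos_left _ m.succ_pos
  have hsδ : (m + 1) * (s * δ) = m * (s * δ) + s * δ := by ring
  have hkδ : 2 * k * (h + δ + 1) = 2 * (k * h) + 2 * (k * δ) + 2 * k := by ring
  have hk1 : 2 * k * (h + 1) = 2 * (k * h) + 2 * k := by ring
  obtain ⟨hr, hcommon⟩ := hP.card_exceptional_eq hG hmatch hstar (by omega) hup hgh (by omega)
    fun i => by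
      have := hlow i
      omega
  have hlarge : ∀ i, 5 * h ≤ #(commonNbrsIn G (P i) (exceptional G P h)) := fun i => by
    have := hlow i
    have := hcommon i
    omega
  refine ⟨exceptional G P h, hr, ?_, ?_⟩
  · refine hP.colorable_induce_compl_exceptional hG.degree hstar hr (by omega) fun j => ?_
    have := hlarge j
    omega
  · refine hP.almostJoined.join_isContained (Copy.induce G _) (fun w => w.2) fun j => ?_
    have := hlarge j
    omega

end Structure

section CompletelyJoinedClasses

variable {V : Type*} [Fintype V] {G : SimpleGraph V} {m s k t b h R : ℕ}
  {K P : Fin (m + 1) → Finset V}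

lemma AlmostJoined.card_exceptional_lt_of_zero (hKK : AlmostJoined G 0 K)
    (hfree : (join (starForest k 1) (completeEquipartiteGraph m s)).Free G)
    (hK : ∀ i, #(K i) = t) :
    #(exceptional G K (s + 2 * k)) < 2 ^ ((m + 1) * t) * (k + 1) := by
  by_contra! hlt
  have hU : #(univ.biUnion K) ≤ (m + 1) * t := by
    simpa using card_biUnion_le_card_mul univ K t fun i _ => (hK i).le
  obtain ⟨A, -, hA⟩ := exists_patternClass_card_le (G := G) (W := univ.biUnion K) k.succ_pos
    ((Nat.mul_le_mul_right _ (Nat.pow_le_pow_right two_pos hU)).trans hlt)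
  obtain ⟨Q, hQA, hQ⟩ := exists_subset_card_eq (k.le_succ.trans hA)
  have hQmem : ∀ x ∈ Q, ∀ i, s + 2 * k ≤ #(nbrsIn G (K i) x) := fun x hx =>
    mem_exceptional.1 (patternClass_subset (hQA hx))
  have hcommon : ∀ j, s ≤ #(commonNbrsIn G (K j) Q) := fun j => by
    obtain ⟨x, hx⟩ := card_pos.1 (k.succ_pos.trans_le hA)
    refine (Nat.le_add_right s _).trans ((mem_exceptional.1 (patternClass_subset hx) j).trans
      (card_le_card fun v hv => ?_))
    obtain ⟨hvK, hxv⟩ := mem_nbrsIn.1 hv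
    refine mem_commonNbrsIn.2 ⟨hvK, fun y hy => ?_⟩
    have hvy : v ∈ nbrsIn G (univ.biUnion K) y := by
      rw [(mem_filter.1 (hQA hy)).2, ← (mem_filter.1 hx).2]
      exact mem_nbrsIn.2 ⟨mem_biUnion.2 ⟨j, mem_univ j, hvK⟩, hxv⟩
    exact (mem_nbrsIn.1 hvy).2
  refine hfree ((join_isContained_join ⟨Embedding.sumInl.toCopy⟩ .rfl).trans
    (hKK.starForest_sum_isContained 0 hQ (disjoint_empty_right Q)
      (H := (⊥ : SimpleGraph Empty)) ⟨⟨Empty.elim, fun {v} => v.elim⟩, fun v => v.elim⟩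
      (fun v => v.elim) (fun x hx => ?_) fun j _ => ?_))
  · have := hQmem x hx 0
    simp only [card_empty]
    omega
  · simpa using hcommon j

/-- The vertices with more than `l` non-neighbours in the union of the disjoint sets `K i`. -/
noncomputable def deficient {ι : Type*} [Fintype ι] (G : SimpleGraph V) (K : ι → Finset V) (l : ℕ) :
    Finset V :=
  {x | l < ∑ i, #(nonNbrsIn G (K i) x)}

@[simp] lemma mem_deficient {ι : Type*} [Fintype ι] {K : ι → Finset V} {l : ℕ} {x : V} :
    x ∈ deficient G K l ↔ l < ∑ i, #(nonNbrsIn G (K i) x) := by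
  simp [deficient]

omit [Fintype V] in
lemma sum_card_nonNbrsIn_comm (G : SimpleGraph V) (W D : Finset V) :
    ∑ x ∈ W, #(nonNbrsIn G D x) = ∑ z ∈ D, #(nonNbrsIn G W z) := by
  simpa only [nonNbrsIn, bipartiteAbove, bipartiteBelow, G.adj_comm] using
    sum_card_bipartiteAbove_eq_sum_card_bipartiteBelow (s := W) (t := D) fun x z => ¬ G.Adj x z

lemma sum_sum_card_nonNbrsIn_le
    (hdeg : ∀ v, m * Fintype.card V ≤ (m + 1) * (G.degree v + 1)) (hK : ∀ i, #(K i) = t) :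
    ∑ x, ∑ i, #(nonNbrsIn G (K i) x) ≤ t * (Fintype.card V + (m + 1)) := by
  have hle : ∑ i, ∑ z ∈ K i, (m + 1) * #(nonNbrsIn G univ z) ≤
      ∑ i : Fin (m + 1), t * (Fintype.card V + (m + 1)) :=
    sum_le_sum fun i _ => (sum_le_card_nsmul _ _ _ fun z _ =>
      mul_card_nonNbrsIn_univ_le (hdeg z)).trans (by rw [hK, smul_eq_mul])
  simp only [sum_const, card_univ, Fintype.card_fin, smul_eq_mul, ← mul_sum,
    ← sum_card_nonNbrsIn_comm] at hle
  rw [sum_comm]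
  exact Nat.le_of_mul_le_mul_left hle m.succ_pos

lemma mul_card_deficient_le
    (hdeg : ∀ v, m * Fintype.card V ≤ (m + 1) * (G.degree v + 1)) (hK : ∀ i, #(K i) = t) :
    b * #(deficient G K (t + b)) ≤
      Fintype.card V * h + t * #(exceptional G K h) + t * (m + 1) := by
  have hvertex : ∀ x, t + (if x ∈ deficient G K (t + b) then b else 0) ≤
      ∑ i, #(nonNbrsIn G (K i) x) + h + if x ∈ exceptional G K h then t else 0 := fun x => by
    by_cases hx : x ∈ deficient G K (t + b)
    · rw [if_pos hx]
      have := mem_deficient.1 hx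
      omega
    by_cases hx' : x ∈ exceptional G K h
    · rw [if_neg hx, if_pos hx']
      omega
    · obtain ⟨i, hi⟩ := exists_mem_sparseTo hx'
      have := mem_sparseTo.1 hi
      have := card_nbrsIn_add_card_nonNbrsIn G (K i) x
      have := hK i
      have := single_le_sum (f := fun i => #(nonNbrsIn G (K i) x)) (fun _ _ => Nat.zero_le _)
        (mem_univ i)
      rw [if_neg hx, if_neg hx']
      omega
  have hsum := sum_le_sum fun x (_ : x ∈ (univ : Finset V)) => hvertex x
  simp only [sum_add_distrib, sum_const, card_univ, smul_eq_mul, sum_ite_mem, univ_inter] at hsum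
  have := sum_sum_card_nonNbrsIn_le hdeg hK
  linarith

lemma card_nonNbrsIn_le_of_notMem_deficient (hK : ∀ i, #(K i) = t) {x : V}
    (hx : x ∉ deficient G K (t + b)) {i j : Fin (m + 1)} (hi : x ∈ sparseTo G (K i) h)
    (hij : i ≠ j) : #(nonNbrsIn G (K j) x) ≤ b + h := by
  have hpair : #(nonNbrsIn G (K i) x) + #(nonNbrsIn G (K j) x) ≤ ∑ l, #(nonNbrsIn G (K l) x) := by
    rw [← sum_pair (f := fun l => #(nonNbrsIn G (K l) x)) hij]
    exact sum_le_sum_of_subset (subset_univ _)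
  have := card_nbrsIn_add_card_nonNbrsIn G (K i) x
  have := hK i
  rw [mem_sparseTo] at hi
  rw [mem_deficient] at hx
  omega

lemma nearPartition_of_card_le (hdeg : ∀ v, m * Fintype.card V ≤ (m + 1) * (G.degree v + 1))
    (indep : ∀ i, G.IsIndepSet (P i)) (disj : Pairwise fun i j => Disjoint (P i) (P j))
    (hR : Fintype.card V ≤ ∑ i, #(P i) + R) (hδ : R + m + 1 ≤ δ) :
    NearPartition G (m + 1) δ P := by
  have hsize : ∀ i, Fintype.card V ≤ (m + 1) * #(P i) + (m + 1) * (R + m) := fun i => by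
    have hrest : ∑ j ∈ univ.erase i, (m + 1) * #(P j) ≤ m * (Fintype.card V + (m + 1)) := by
      simpa using sum_le_card_nsmul (univ.erase i) _ _ fun j _ =>
        mul_card_le_of_isIndepSet hdeg (indep j)
    have hmul := Nat.mul_le_mul_left (m + 1) hR
    rw [← mul_sum] at hrest
    rw [← add_sum_erase univ (fun i => #(P i)) (mem_univ i)] at hmul
    linarith
  refine ⟨indep, disj, fun i j hij u hu => ?_, fun i => (hsize i).trans (by gcongr; omega)⟩
  have hunion : #(P i) + #(nonNbrsIn G (P j) u) ≤ #(nonNbrsIn G univ u) := by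
    rw [← card_union_of_disjoint (t := nonNbrsIn G (P j) u)
      ((disj hij).mono_right (filter_subset _ _))]
    refine card_le_card (union_subset (fun v hv => ?_) (nonNbrsIn_mono (subset_univ _)))
    exact mem_nonNbrsIn.2 ⟨mem_univ v, fun huv => indep i hu hv huv.ne huv⟩
  have hmul := Nat.mul_le_mul_left (m + 1) hunion
  have := mul_card_nonNbrsIn_univ_le (hdeg u)
  have := hsize i
  refine (Nat.le_of_mul_le_mul_left (?_ : (m + 1) * _ ≤ (m + 1) * (R + m + 1)) m.succ_pos).trans hδ
  linarith

lemma AlmostJoined.exists_nearPartition (hKK : AlmostJoined G 0 K)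
    (hfree : (join (starForest k 1) (completeEquipartiteGraph m s)).Free G)
    (hdeg : ∀ v, m * Fintype.card V ≤ (m + 1) * (G.degree v + 1)) (hK : ∀ i, #(K i) = t)
    (ht : 2 * k * (b + h) + s + b + 2 * h ≤ t)
    (hδ : #(exceptional G K h) + #(deficient G K (t + b)) + (m + 1) * (2 * k) + m + 1 ≤ δ) :
    ∃ P : Fin (m + 1) → Finset V, NearPartition G (m + 1) δ P := by
  let Y : Fin (m + 1) → Finset V := fun i => sparseTo G (K i) h \ deficient G K (t + b)
  have hY : ∀ i j, i ≠ j → ∀ x ∈ Y i, #(nonNbrsIn G (K j) x) ≤ b + h := fun i j hij x hx =>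
    card_nonNbrsIn_le_of_notMem_deficient hK (mem_sdiff.1 hx).2 (mem_sdiff.1 hx).1 hij
  have hYdisj : Pairwise fun i j => Disjoint (Y i) (Y j) := fun i j hij =>
    disjoint_left.2 fun x hxi hxj => by
      have := hY i j hij x hxi
      have := mem_sparseTo.1 (mem_sdiff.1 hxj).1
      have := card_nbrsIn_add_card_nonNbrsIn G (K j) x
      have := hK j
      omega
  choose C _ hC hind using fun i => (hKK.comp_injective
    (Fin.succAbove_right_injective (p := i))).exists_isIndepSet_sdiff hfree
    (fun j => hY i _ (Fin.succAbove_ne i j).symm) fun j => by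
      simp only [Function.comp_apply, hK]
      omega
  refine ⟨fun i => Y i \ C i, nearPartition_of_card_le hdeg hind
    (fun i j hij => (hYdisj hij).mono sdiff_subset sdiff_subset) ?_ hδ⟩
  have hcover : (univ : Finset V) ⊆ univ.biUnion (fun i => Y i \ C i) ∪
      (exceptional G K h ∪ deficient G K (t + b) ∪ univ.biUnion C) := fun x _ => by
    by_cases hx : x ∈ exceptional G K h
    · simp only [mem_union, hx, true_or, or_true]
    obtain ⟨i, hi⟩ := exists_mem_sparseTo hx
    by_cases hxC : x ∈ C i
    · exact mem_union_right _ (mem_union_right _ (mem_biUnion.2 ⟨i, mem_univ i, hxC⟩))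
    by_cases hx' : x ∈ deficient G K (t + b)
    · exact mem_union_right _ (mem_union_left _ (mem_union_right _ hx'))
    · exact mem_union_left _ (mem_biUnion.2
        ⟨i, mem_univ i, mem_sdiff.2 ⟨mem_sdiff.2 ⟨hi, hx'⟩, hxC⟩⟩)
  have hsum := card_biUnion_le (s := univ) (t := fun i => Y i \ C i)
  have hCcard : #(univ.biUnion C) ≤ (m + 1) * (2 * k) := by
    simpa using card_biUnion_le_card_mul univ C _ fun i _ => hC i
  have hcard := (card_le_card hcover).trans (card_union_le _ _)
  have hrest := card_union_le (exceptional G K h ∪ deficient G K (t + b)) (univ.biUnion C)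
  have := card_union_le (exceptional G K h) (deficient G K (t + b))
  rw [card_univ] at hcard
  omega

end CompletelyJoinedClasses

section LargeGraphs

lemma exists_almostJoined_zero {V : Type*} {G : SimpleGraph V} {r t : ℕ}
    (κ : Copy (completeEquipartiteGraph r t) G) :
    ∃ K : Fin r → Finset V, (∀ i, #(K i) = t) ∧ AlmostJoined G 0 K := by
  refine ⟨fun i => univ.image fun j => κ (i, j), fun i => ?_, fun i j hij u hu => ?_⟩
  · have hinj : Function.Injective fun j => κ (i, j) :=
      κ.injective.comp (Prod.mk_right_injective i)
    rw [card_image_of_injective _ hinj, card_univ, Fintype.card_fin]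
  · obtain ⟨a, -, rfl⟩ := mem_image.1 hu
    refine (card_eq_zero.2 (filter_eq_empty_iff.2 fun v hv => not_not.2 ?_)).le
    obtain ⟨c, -, rfl⟩ := mem_image.1 hv
    exact κ.toHom.map_adj (by simpa using hij)

lemma le_minDegree_of_forall_le {n m : ℕ} {G : SimpleGraph (Fin n)} (hm : 0 < m)
    (hn : 2 * m * (m + 1) < n) (hdeg : ∀ v, m * n ≤ (m + 1) * (G.degree v + 1)) :
    (1 - 1 / m + 1 / (2 * m * (m + 1)) : ℝ) * n ≤ G.minDegree := by
  have : Nonempty (Fin n) := ⟨⟨0, by omega⟩⟩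
  obtain ⟨v, hv⟩ := G.exists_minimal_degree_vertex
  have hmin : (m : ℝ) * n ≤ (m + 1) * (G.minDegree + 1) := by
    rw [hv]
    exact_mod_cast hdeg v
  have : (0 : ℝ) < m := by exact_mod_cast hm
  have hn' : (2 * m * (m + 1) : ℝ) ≤ n := by exact_mod_cast hn.le
  have heq : (1 - 1 / m + 1 / (2 * m * (m + 1)) : ℝ) * n =
      (2 * m * (m + 1) * n - 2 * (m + 1) * n + n) / (2 * m * (m + 1)) := by
    field_simp
  rw [heq, div_le_iff₀ (by positivity)]
  nlinarith

theorem exists_nearPartition (m s k E : ℕ) (hm : 0 < m) (hE : 0 < E) :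
    ∃ n₁ : ℕ, ∀ n ≥ n₁, ∀ G : SimpleGraph (Fin n),
      (join (starForest k 1) (completeEquipartiteGraph m s)).Free G →
      (∀ v, m * n ≤ (m + 1) * (G.degree v + 1)) →
      ∃ P : Fin (m + 1) → Finset (Fin n), NearPartition G (m + 1) (n / E) P := by
  obtain ⟨h, hh⟩ : ∃ h, h = s + 2 * k := ⟨_, rfl⟩
  obtain ⟨b, hb⟩ : ∃ b, b = 2 * E * (h + 1) := ⟨_, rfl⟩
  obtain ⟨t, ht⟩ : ∃ t, t = 2 * k * (b + h) + s + b + 2 * h := ⟨_, rfl⟩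
  obtain ⟨c, hc⟩ : ∃ c, c = 2 ^ ((m + 1) * t) * (k + 1) := ⟨_, rfl⟩
  obtain ⟨N, hN⟩ := Filter.eventually_atTop.1
    (eventually_completeEquipartiteGraph_isContained_of_minDegree
      (show (0 : ℝ) < 1 / (2 * m * (m + 1)) by positivity) m t)
  refine ⟨N + 2 * m * (m + 1) + (t * c + t * (m + 1)) +
    2 * E * (c + (m + 1) * (2 * k) + m + 1) + 1, fun n hn G hfree hdeg => ?_⟩
  obtain ⟨κ⟩ := hN n (by omega) (le_minDegree_of_forall_le hm (by omega) hdeg)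
  obtain ⟨K, hK, hKK⟩ := exists_almostJoined_zero κ
  refine hKK.exists_nearPartition (b := b) (h := h) hfree (by simpa using hdeg) hK ht.ge ?_
  have hexc : #(exceptional G K h) ≤ c := hc ▸ hh ▸ (hKK.card_exceptional_lt_of_zero hfree hK).le
  have hdef : 2 * E * #(deficient G K (t + b)) ≤ n := by
    refine Nat.le_of_mul_le_mul_left (?_ : (h + 1) * _ ≤ (h + 1) * n) h.succ_pos
    calc (h + 1) * (2 * E * #(deficient G K (t + b)))
        = b * #(deficient G K (t + b)) := by rw [hb]; ring
      _ ≤ n * h + t * #(exceptional G K h) + t * (m + 1) := by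
        simpa using mul_card_deficient_le (h := h) (b := b) (by simpa using hdeg) hK
      _ ≤ n * h + (t * c + t * (m + 1)) := by
        rw [add_assoc]
        gcongr
      _ ≤ (h + 1) * n := by rw [add_one_mul, mul_comm n h]; omega
  rw [Nat.le_div_iff_mul_le hE]
  have := Nat.mul_le_mul_left (2 * E) hexc
  refine Nat.le_of_mul_le_mul_left (?_ : 2 * _ ≤ 2 * n) two_pos
  have : 2 * E * (c + (m + 1) * (2 * k) + m + 1) ≤ n := by omega
  linarith

theorem exists_structure (m r s k : ℕ) (hm : 0 < m) :
    ∃ n₁ : ℕ, ∀ n ≥ n₁, ∀ G : SimpleGraph (Fin n),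
      (join (starForest k 1) (completeEquipartiteGraph m s)).Free G →
      (join (starForest r s ⊕g (⊤ : SimpleGraph (Fin 2)))
        (completeEquipartiteGraph m s)).Free G →
      TuranDegrees G m r →
      ∃ X : Finset (Fin n), #X = r ∧ (G.induce (X : Set (Fin n))ᶜ).Colorable (m + 1) ∧
        join (G.induce (X : Set (Fin n))) (completeEquipartiteGraph (m + 1) s) ⊑ G := by
  obtain ⟨b, hb⟩ : ∃ b, b = 8 * (m + 1) * (k + 1) := ⟨_, rfl⟩
  obtain ⟨c, hc⟩ : ∃ c, c = 2 ^ ((r + 1) * (2 * (17 * (k + 1))) ^ (m + 1) + 1) := ⟨_, rfl⟩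
  obtain ⟨d, hd⟩ : ∃ d, d = (m + 1) * s + s + r * s + (m + 1) + r + 2 * k + 2 := ⟨_, rfl⟩
  have hb0 : 0 < b := by rw [hb]; positivity
  have hc0 : 0 < c := by rw [hc]; positivity
  have hd0 : 0 < d := by omega
  obtain ⟨n₁, hn₁⟩ := exists_nearPartition m s k (b * c * (2 * d)) hm (by positivity)
  refine ⟨n₁ + b * c * (2 * d), fun n hn G hmatch hstar hG => ?_⟩
  obtain ⟨P, hP⟩ := hn₁ n (by omega) G hmatch (by simpa using hG.degree)
  have hg : 2 * d ≤ n / b / c := by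
    rw [Nat.div_div_eq_div_mul, Nat.le_div_iff_mul_le (by positivity), mul_comm]
    omega
  have hδ : 2 * d * (n / (b * c * (2 * d))) ≤ n / b / c := by
    rw [Nat.div_div_eq_div_mul, ← Nat.div_div_eq_div_mul n (b * c)]
    exact Nat.mul_div_le _ _
  have hbn : b ≤ b * (n / b) :=
    Nat.le_mul_of_pos_right _ (by have := Nat.div_le_self (n / b) c; omega)
  refine hP.exists_structure hG hmatch hstar (h := n / b) (g := n / b / c) ?_ ?_ ?_ ?_
  · rw [← hb, Fintype.card_fin]
    exact Nat.mul_div_le n b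
  · have hlt := Nat.lt_mul_div_succ n hb0
    rw [Fintype.card_fin, show 16 * (m + 1) * (k + 1) = 2 * b by rw [hb]; ring]
    linarith
  · rw [← hc]
    exact Nat.div_mul_le_self _ _
  · refine le_trans (?_ : _ ≤ d * (n / (b * c * (2 * d))) + d) (by linarith)
    generalize n / (b * c * (2 * d)) = δ
    refine (Nat.le_add_right _ ((s + r + 2) * δ + (m + 1) * s + (m + 1))).trans_eq ?_
    rw [hd]
    ring

end LargeGraphs

section EdgeCount

variable {V W U : Type*} {G : SimpleGraph V} {H : SimpleGraph W} {L : SimpleGraph U}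

lemma ncard_edgeSet_congr (e : G ≃g H) : G.edgeSet.ncard = H.edgeSet.ncard :=
  Nat.card_congr e.mapEdgeSet

variable [Fintype V] [Fintype W]

lemma ncard_edgeSet_eq_card_edgeFinset (G : SimpleGraph V) [DecidableRel G.Adj] :
    G.edgeSet.ncard = #G.edgeFinset := by
  rw [Set.ncard_eq_toFinset_card', edgeFinset]

lemma two_mul_ncard_edgeSet (G : SimpleGraph V) : 2 * G.edgeSet.ncard = ∑ v, G.degree v := by
  rw [ncard_edgeSet_eq_card_edgeFinset, ← sum_degrees_eq_twice_card_edges]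

lemma two_mul_ncard_edgeSet_induce {V : Type*} (G : SimpleGraph V) (X : Finset V) :
    2 * (G.induce (X : Set V)).edgeSet.ncard = ∑ v ∈ X, #(nbrsIn G X v) := by
  rw [two_mul_ncard_edgeSet, ← sum_finset_coe (fun v => #(nbrsIn G X v)) X]
  refine sum_congr rfl fun v _ => ?_
  rw [← card_neighborFinset_eq_degree, ← card_map (Function.Embedding.subtype (· ∈ (X : Set V)))]
  congr 1
  ext u
  simp [and_comm]

lemma ncard_edgeSet_join (G : SimpleGraph V) (H : SimpleGraph W) :
    (join G H).edgeSet.ncard =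
      G.edgeSet.ncard + Fintype.card V * Fintype.card W + H.edgeSet.ncard := by
  have hinl (v : V) : (join G H).degree (.inl v) = G.degree v + Fintype.card W := by
    simp [← card_neighborFinset_eq_degree, neighborFinset_eq_filter, card_filter,
      -sum_boole]
  have hinr (w : W) : (join G H).degree (.inr w) = Fintype.card V + H.degree w := by
    simp [← card_neighborFinset_eq_degree, neighborFinset_eq_filter, card_filter,
      -sum_boole]
  have h := two_mul_ncard_edgeSet (join G H)
  rw [Fintype.sum_sum_type] at h
  simp only [hinl, hinr, sum_add_distrib, sum_const, card_univ, smul_eq_mul,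
    ← two_mul_ncard_edgeSet, mul_comm (Fintype.card W)] at h
  omega

lemma card_nbrsIn_add_card_nbrsIn_compl (G : SimpleGraph V) (X : Finset V) (v : V) :
    #(nbrsIn G X v) + #(nbrsIn G Xᶜ v) = G.degree v := by
  rw [← card_nbrsIn_univ, nbrsIn, nbrsIn, nbrsIn, ← union_compl X, filter_union,
    card_union_of_disjoint (disjoint_filter_filter disjoint_compl_right)]

lemma ncard_edgeSet_split (G : SimpleGraph V) (X : Finset V) :
    G.edgeSet.ncard = (G.induce (X : Set V)).edgeSet.ncard + ∑ v ∈ X, #(nbrsIn G Xᶜ v) +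
      (G.induce (X : Set V)ᶜ).edgeSet.ncard := by
  have h := two_mul_ncard_edgeSet G
  have hX := two_mul_ncard_edgeSet_induce G X
  have hXc := two_mul_ncard_edgeSet_induce G Xᶜ
  rw [coe_compl] at hXc
  have hcomm := sum_card_nbrsIn_comm G Xᶜ X
  simp only [← sum_add_sum_compl X, ← card_nbrsIn_add_card_nbrsIn_compl G X,
    sum_add_distrib] at h
  omega

lemma ncard_edgeSet_add_induce (G : SimpleGraph V) (X : Finset V) :
    G.edgeSet.ncard + (G.induce (X : Set V)).edgeSet.ncard =
      (G.induce (X : Set V)ᶜ).edgeSet.ncard + ∑ v ∈ X, G.degree v := by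
  have h := ncard_edgeSet_split G X
  have hX := two_mul_ncard_edgeSet_induce G X
  simp only [← card_nbrsIn_add_card_nbrsIn_compl G X, sum_add_distrib]
  omega

lemma ncard_edgeSet_le_extremalNumber (h : L.Free G) :
    G.edgeSet.ncard ≤ extremalNumber (Fintype.card V) L := by
  rw [ncard_edgeSet_eq_card_edgeFinset]
  exact card_edgeFinset_le_extremalNumber h

lemma card_coe_compl (X : Finset V) : Fintype.card ↑(X : Set V)ᶜ = Fintype.card V - #X := by
  rw [Fintype.card_compl_set]
  exact congrArg _ (Fintype.card_coe X)

lemma ncard_edgeSet_add_induce_le (h : L.Free G) (X : Finset V) :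
    G.edgeSet.ncard + (G.induce (X : Set V)).edgeSet.ncard ≤
      extremalNumber (Fintype.card V - #X) L + ∑ v ∈ X, G.degree v := by
  rw [ncard_edgeSet_add_induce, ← card_coe_compl]
  gcongr
  exact ncard_edgeSet_le_extremalNumber fun hL => h (hL.trans ⟨Copy.induce G _⟩)

end EdgeCount

section TuranNumbers

variable {V : Type*} [Fintype V] {G : SimpleGraph V} {p : ℕ}

lemma exists_isTuranMaximal_iso_turanGraph (V : Type*) [Fintype V] (hp : 0 < p) :
    ∃ H : SimpleGraph V, H.IsTuranMaximal p ∧ Nonempty (H ≃g turanGraph (Fintype.card V) p) := by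
  obtain ⟨H, _, hH⟩ := exists_isTuranMaximal (V := V) hp
  exact ⟨H, by convert! hH, (isTuranMaximal_iff_nonempty_iso_turanGraph hp).1 hH⟩

lemma ncard_edgeSet_le_turanGraph (hp : 0 < p) (h : G.CliqueFree (p + 1)) :
    G.edgeSet.ncard ≤ (turanGraph (Fintype.card V) p).edgeSet.ncard := by
  obtain ⟨H, hH, ⟨e⟩⟩ := exists_isTuranMaximal_iso_turanGraph V hp
  rw [← ncard_edgeSet_congr e, ncard_edgeSet_eq_card_edgeFinset, ncard_edgeSet_eq_card_edgeFinset]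
  convert hH.2 h

lemma nonempty_iso_turanGraph (hp : 0 < p) (h : G.CliqueFree (p + 1))
    (hG : G.edgeSet.ncard = (turanGraph (Fintype.card V) p).edgeSet.ncard) :
    Nonempty (G ≃g turanGraph (Fintype.card V) p) := by
  refine (isTuranMaximal_iff_nonempty_iso_turanGraph hp).1 ⟨h, fun G' _ hG' => ?_⟩
  have hle := ncard_edgeSet_le_turanGraph hp hG'
  rwa [← hG, ncard_edgeSet_eq_card_edgeFinset, ncard_edgeSet_eq_card_edgeFinset] at hle

lemma ncard_edgeSet_turanGraph_add (n p : ℕ) : (turanGraph (n + p) p).edgeSet.ncard =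
    (turanGraph n p).edgeSet.ncard + n * (p - 1) + p.choose 2 := by
  rw [ncard_edgeSet_eq_card_edgeFinset, ncard_edgeSet_eq_card_edgeFinset,
    card_edgeFinset_turanGraph_add]

lemma card_filter_mod_eq_last (n : ℕ) (hp : 0 < p) :
    #{x : Fin n | (x : ℕ) % p = n % p} = n / p := by
  have hcount := Nat.count_modEq_card n hp n
  rw [if_neg (lt_irrefl _), add_zero, Nat.count_eq_card_filter_range] at hcount
  simp only [Nat.ModEq] at hcount
  rw [card_filter, Fin.sum_univ_eq_sum_range (fun x => if x % p = n % p then 1 else 0),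
    ← card_filter]
  convert! hcount

lemma ncard_edgeSet_turanGraph_succ (n : ℕ) (hp : 0 < p) :
    (turanGraph (n + 1) p).edgeSet.ncard + n / p = (turanGraph n p).edgeSet.ncard + n := by
  have hsplit := card_filter_add_card_filter_not (s := univ) fun x : Fin n => (x : ℕ) % p = n % p
  rw [card_filter_mod_eq_last n hp, card_univ, Fintype.card_fin] at hsplit
  have hn := two_mul_ncard_edgeSet (turanGraph n p)
  have hn' := two_mul_ncard_edgeSet (turanGraph (n + 1) p)
  simp only [← card_neighborFinset_eq_degree, neighborFinset_eq_filter, card_filter,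
    turanGraph_adj] at hn hn' hsplit
  simp only [Fin.sum_univ_castSucc, Fin.val_castSucc, Fin.val_last, sum_add_distrib,
    ne_comm (a := n % p), ne_eq, not_true_eq_false, if_false, add_zero] at hn' hsplit hn
  omega

end TuranNumbers

section JoinIso

variable {V V' W W' : Type*} {G : SimpleGraph V} {G' : SimpleGraph V'} {H : SimpleGraph W}
  {H' : SimpleGraph W'}

/-- The join of two graph isomorphisms. -/
def joinCongr (e : G ≃g G') (f : H ≃g H') : join G H ≃g join G' H' where
  toEquiv := Equiv.sumCongr e.toEquiv f.toEquiv
  map_rel_iff' := by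
    rintro (a | a) (b | b)
    · simpa using e.map_adj_iff
    · simp
    · simp
    · simpa using f.map_adj_iff

lemma nonempty_iso_join_induce {X : Set V} (h : ∀ u ∈ X, ∀ v ∉ X, G.Adj u v) :
    Nonempty (G ≃g join (G.induce X) (G.induce Xᶜ)) := by
  refine ⟨RelIso.symm ⟨Equiv.Set.sumCompl X, ?_⟩⟩
  rintro (⟨a, ha⟩ | ⟨a, ha⟩) (⟨b, hb⟩ | ⟨b, hb⟩)
  · simp
  · simpa using h a ha b hb
  · simpa using (h b hb a ha).symm
  · simp

end JoinIso

section HPrime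

variable {n m p q : ℕ}

lemma hPrime_eq (n p q : ℕ) : hPrime n p q =
    (q - 1) * (n - (q - 1)) + (turanGraph (n - (q - 1)) p).edgeSet.ncard := by
  simp [hPrime, turanWith, ncard_edgeSet_join]

lemma ncard_edgeSet_turanWith (n p q : ℕ) (Q : SimpleGraph (Fin (q - 1))) :
    (turanWith n p q Q).edgeSet.ncard = hPrime n p q + Q.edgeSet.ncard := by
  rw [hPrime_eq, turanWith, ncard_edgeSet_join, Fintype.card_fin, Fintype.card_fin]
  omega

lemma hPrime_succ (hp : 0 < p) (hn : q - 1 ≤ n) :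
    hPrime (n + 1) p q + (n - (q - 1)) / p = hPrime n p q + n := by
  obtain ⟨l, rfl⟩ := Nat.exists_eq_add_of_le hn
  have hturan := ncard_edgeSet_turanGraph_succ l hp
  rw [hPrime_eq, hPrime_eq, add_assoc (q - 1), Nat.add_sub_cancel_left, Nat.add_sub_cancel_left,
    mul_add_one]
  omega

lemma hPrime_add (hn : q - 1 ≤ n) :
    hPrime (n + (m + 1)) (m + 1) q =
      hPrime n (m + 1) q + m * n + (q - 1) + (m + 1).choose 2 := by
  obtain ⟨l, rfl⟩ := Nat.exists_eq_add_of_le hn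
  rw [hPrime_eq, hPrime_eq, add_assoc, Nat.add_sub_cancel_left, Nat.add_sub_cancel_left,
    ncard_edgeSet_turanGraph_add, Nat.add_sub_cancel]
  ring

end HPrime

section FamilyExtremal

variable {n : ℕ} {𝓑 : GraphFamily}

lemma bddAbove_ncard_edgeSet (n : ℕ) (𝓑 : GraphFamily) :
    BddAbove {e | ∃ G : SimpleGraph (Fin n), FamilyFree 𝓑 G ∧ G.edgeSet.ncard = e} :=
  ((Set.toFinite _).image (fun G : SimpleGraph (Fin n) => G.edgeSet.ncard)).bddAbove

lemma ncard_edgeSet_le_familyEx {Q : SimpleGraph (Fin n)} (hQ : FamilyFree 𝓑 Q) :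
    Q.edgeSet.ncard ≤ familyEx n 𝓑 :=
  le_csSup (bddAbove_ncard_edgeSet n 𝓑) ⟨Q, hQ, rfl⟩

lemma familyEX_nonempty {Q : SimpleGraph (Fin n)} (hQ : FamilyFree 𝓑 Q) :
    (familyEX n 𝓑).Nonempty :=
  Nat.sSup_mem (s := {e | ∃ G : SimpleGraph (Fin n), FamilyFree 𝓑 G ∧ G.edgeSet.ncard = e})
    ⟨_, Q, hQ, rfl⟩ (bddAbove_ncard_edgeSet n 𝓑)

end FamilyExtremal

section Structure

variable {V : Type*} [Fintype V] {G : SimpleGraph V} {p q : ℕ}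

lemma ncard_edgeSet_le_hPrime_add_of_colorable_compl {X : Finset V} (hp : 0 < p) (hX : #X = q - 1)
    (hcol : (G.induce (X : Set V)ᶜ).Colorable p) :
    G.edgeSet.ncard ≤ hPrime (Fintype.card V) p q + (G.induce (X : Set V)).edgeSet.ncard ∧
      (G.edgeSet.ncard = hPrime (Fintype.card V) p q + (G.induce (X : Set V)).edgeSet.ncard →
        Nonempty (G ≃g join (G.induce (X : Set V))
          (turanGraph (Fintype.card V - (q - 1)) p))) := by
  have hfree := hcol.cliqueFree p.lt_succ_self
  have hcard : Fintype.card ↑(X : Set V)ᶜ = Fintype.card V - (q - 1) := by rw [card_coe_compl, hX]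
  have hcardX : #Xᶜ = Fintype.card V - (q - 1) := by rw [card_compl, hX]
  have hturan := ncard_edgeSet_le_turanGraph hp hfree
  have hcross : ∀ v ∈ X, #(nbrsIn G Xᶜ v) ≤ #Xᶜ := fun v _ => card_le_card nbrsIn_subset
  have hcross' := sum_le_card_nsmul _ _ _ hcross
  have hsplit := ncard_edgeSet_split G X
  rw [hX, hcardX, smul_eq_mul] at hcross'
  rw [hcard] at hturan
  rw [hPrime_eq]
  refine ⟨by omega, fun heq => ?_⟩
  obtain ⟨f⟩ := nonempty_iso_turanGraph hp hfree (by rw [hcard]; omega)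
  have hfull : ∀ v ∈ X, #(nbrsIn G Xᶜ v) = #Xᶜ := by
    refine (sum_eq_sum_iff_of_le hcross).1 ?_
    rw [sum_const, smul_eq_mul, hX, hcardX]
    omega
  obtain ⟨g⟩ := nonempty_iso_join_induce (G := G) (X := (X : Set V)) fun u hu v hv =>
    card_filter_eq_iff.1 (hfull u hu) v (mem_compl.2 hv)
  rw [hcard] at f
  exact ⟨g.trans (joinCongr Iso.refl f)⟩

end Structure

/-- Simonovits' progressive induction: going down from `n` to `n - d` increases the excess `φ` by at
least one, so `p * φ n + n` stays bounded as long as `S` fails. -/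
lemma eventually_of_progressive {φ : ℕ → ℕ} {S : ℕ → Prop} {p n₂ : ℕ}
    (hS : ∀ n, S n → φ n = 0)
    (hstep : ∀ n ≥ n₂, ¬ S n → ∃ d, 1 ≤ d ∧ d ≤ p ∧ d ≤ n ∧ φ n < φ (n - d)) :
    ∃ n₀, ∀ n ≥ n₀, S n := by
  obtain ⟨M, hM⟩ : ∃ M, ∀ j < n₂, φ j ≤ M :=
    ⟨(range n₂).sup φ, fun j hj => le_sup (f := φ) (mem_range.2 hj)⟩
  have hbound (n : ℕ) (hn : n < n₂ ∨ ¬ S n) : p * φ n + n ≤ p * M + n₂ := by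
    induction n using Nat.strong_induction_on with
    | _ n ih =>
      by_cases hlt : n < n₂
      · have := Nat.mul_le_mul_left p (hM n hlt)
        omega
      · obtain ⟨d, hd, hdp, hdn, hφ⟩ := hstep n (not_lt.1 hlt) (hn.resolve_left hlt)
        have hih := ih (n - d) (by omega) (.inr fun hs => by have := hS _ hs; omega)
        have := Nat.mul_le_mul_left p (Nat.succ_le_of_lt hφ)
        rw [Nat.succ_eq_add_one, mul_add_one] at this
        omega
  refine ⟨p * M + n₂ + 1, fun n hn => ?_⟩
  by_contra h
  have := hbound n (.inr h)
  omega

section Extremal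

variable {U : Type*} {L : SimpleGraph U} {m n p q s k : ℕ} {𝓑 : GraphFamily}

/-- The extremal graphs for `L` on `n` vertices are the graphs obtained from `H'(n, p, q)` by
embedding an extremal graph for `𝓑` in its part with `q - 1` vertices. -/
structure ExtremalTuranWith (L : SimpleGraph U) (𝓑 : GraphFamily) (p q n : ℕ) : Prop where
  extremalNumber_eq : extremalNumber n L = hPrime n p q + familyEx (q - 1) 𝓑
  mem_graphEX_iff : ∀ G : SimpleGraph (Fin n),
    G ∈ graphEX n L ↔ ∃ Q ∈ familyEX (q - 1) 𝓑, Nonempty (G ≃g turanWith n p q Q)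

lemma le_extremalNumber (hne : (familyEX (q - 1) 𝓑).Nonempty) (hn : q - 1 ≤ n)
    (hfree : ∀ Q : SimpleGraph (Fin (q - 1)), FamilyFree 𝓑 Q → L.Free (turanWith n p q Q)) :
    hPrime n p q + familyEx (q - 1) 𝓑 ≤ extremalNumber n L := by
  obtain ⟨Q, hQ, hQx⟩ := hne
  have hle := ncard_edgeSet_le_extremalNumber (hfree Q hQ)
  rwa [ncard_edgeSet_turanWith, hQx, Fintype.card_sum, Fintype.card_fin, Fintype.card_fin,
    Nat.add_sub_cancel' hn] at hle

lemma ncard_edgeSet_le_hPrime_add_familyEx {G : SimpleGraph (Fin n)} {X : Finset (Fin n)}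
    (hp : 0 < p) (hG : L.Free G)
    (hgood : ∀ Q : SimpleGraph (Fin (q - 1)),
      L.Free (join Q (completeEquipartiteGraph p s)) → FamilyFree 𝓑 Q)
    (hX : #X = q - 1) (hcol : (G.induce (X : Set (Fin n))ᶜ).Colorable p)
    (hjoin : join (G.induce (X : Set (Fin n))) (completeEquipartiteGraph p s) ⊑ G) :
    G.edgeSet.ncard ≤ hPrime n p q + familyEx (q - 1) 𝓑 ∧
      (G.edgeSet.ncard = hPrime n p q + familyEx (q - 1) 𝓑 →
        ∃ Q ∈ familyEX (q - 1) 𝓑, Nonempty (G ≃g turanWith n p q Q)) := by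
  let Q := (G.induce (X : Set (Fin n))).comap (X.equivFinOfCardEq hX).symm
  let e : Q ≃g G.induce (X : Set (Fin n)) := ⟨(X.equivFinOfCardEq hX).symm, Iff.rfl⟩
  have hQ : FamilyFree 𝓑 Q := hgood Q fun hL =>
    hG (hL.trans ((join_isContained_join e.isContained (IsContained.refl _)).trans hjoin))
  have hQle := ncard_edgeSet_le_familyEx hQ
  obtain ⟨hle, hiso⟩ := ncard_edgeSet_le_hPrime_add_of_colorable_compl hp hX hcol
  rw [Fintype.card_fin, ← ncard_edgeSet_congr e] at hle hiso
  refine ⟨by omega, fun heq => ?_⟩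
  obtain ⟨f⟩ := hiso (by omega)
  exact ⟨Q, ⟨hQ, by omega⟩, ⟨f.trans (joinCongr e.symm Iso.refl)⟩⟩

lemma extremalTuranWith_of_forall (hL : L ≠ ⊥)
    (hle : hPrime n p q + familyEx (q - 1) 𝓑 ≤ extremalNumber n L)
    (hfree : ∀ Q : SimpleGraph (Fin (q - 1)), FamilyFree 𝓑 Q → L.Free (turanWith n p q Q))
    (hupper : ∀ G ∈ graphEX n L, G.edgeSet.ncard ≤ hPrime n p q + familyEx (q - 1) 𝓑 ∧
      (G.edgeSet.ncard = hPrime n p q + familyEx (q - 1) 𝓑 →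
        ∃ Q ∈ familyEX (q - 1) 𝓑, Nonempty (G ≃g turanWith n p q Q))) :
    ExtremalTuranWith L 𝓑 p q n := by
  have hex : extremalNumber n L = hPrime n p q + familyEx (q - 1) 𝓑 := by
    obtain ⟨G, _, hG⟩ := exists_isExtremal_free (V := Fin n) hL
    rw [isExtremal_free_iff, Fintype.card_fin, ← ncard_edgeSet_eq_card_edgeFinset] at hG
    exact (hG.2 ▸ (hupper G hG).1).antisymm hle
  refine ⟨hex, fun G => ⟨fun hG => (hupper G hG).2 (hG.2.trans hex), ?_⟩⟩
  rintro ⟨Q, ⟨hQ, hQx⟩, ⟨e⟩⟩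
  refine ⟨fun hLG => hfree Q hQ (hLG.trans e.isContained), ?_⟩
  rw [ncard_edgeSet_congr e, ncard_edgeSet_turanWith, hQx, hex]

lemma ncard_edgeSet_add_hPrime_lt_of_degree {G : SimpleGraph (Fin n)} (hG : L.Free G)
    (hn : q - 1 < n) {v : Fin n} (hv : (m + 1) * (G.degree v + 1) < m * n) :
    G.edgeSet.ncard + hPrime (n - 1) (m + 1) q <
      extremalNumber (n - 1) L + hPrime n (m + 1) q := by
  have hdel := ncard_edgeSet_add_induce_le hG {v}
  rw [card_singleton, sum_singleton, Fintype.card_fin] at hdel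
  obtain ⟨l, rfl⟩ : ∃ l, n = l + 1 := Nat.exists_eq_succ_of_ne_zero (by omega)
  have hsucc := hPrime_succ (p := m + 1) (q := q) (n := l) m.succ_pos (by omega)
  have hdeg : G.degree v + 1 + (l - (q - 1)) / (m + 1) < l + 1 := by
    have := Nat.div_mul_le_self (l - (q - 1)) (m + 1)
    have : l - (q - 1) ≤ l := Nat.sub_le _ _
    refine lt_of_mul_lt_mul_left (a := m + 1) ?_ (Nat.zero_le _)
    linarith
  rw [Nat.add_sub_cancel] at hdel ⊢
  omega

lemma ncard_edgeSet_induce_of_isClique {V : Type*} {G : SimpleGraph V} {S : Finset V}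
    (hS : G.IsClique S) : (G.induce (S : Set V)).edgeSet.ncard = (#S).choose 2 := by
  rw [induce_eq_top.2 hS, ncard_edgeSet_eq_card_edgeFinset,
    card_edgeFinset_top_eq_card_choose_two]
  congr 1
  exact Fintype.card_coe S

lemma ncard_edgeSet_add_hPrime_lt_of_clique {G : SimpleGraph (Fin n)} (hG : L.Free G)
    (hn : q - 1 + (m + 1) ≤ n) {S : Finset (Fin n)} (hS : G.IsNClique (m + 1) S)
    (hlt : ∑ v ∈ S, G.degree v < m * n + (q - 1)) :
    G.edgeSet.ncard + hPrime (n - (m + 1)) (m + 1) q <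
      extremalNumber (n - (m + 1)) L + hPrime n (m + 1) q := by
  have hdel := ncard_edgeSet_add_induce_le hG S
  rw [ncard_edgeSet_induce_of_isClique hS.isClique, hS.card_eq, Fintype.card_fin] at hdel
  obtain ⟨l, rfl⟩ : ∃ l, n = l + (m + 1) := ⟨n - (m + 1), by omega⟩
  have hadd := hPrime_add (m := m) (q := q) (n := l) (by omega)
  have hchoose : 2 * (m + 1).choose 2 = m * (m + 1) := by
    rw [mul_comm, Nat.choose_two_right, Nat.add_sub_cancel, mul_comm m,
      Nat.div_two_mul_two_of_even (by simpa using Nat.even_mul_pred_self (m + 1))]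
  rw [mul_add, ← hchoose] at hlt
  rw [Nat.add_sub_cancel] at hdel ⊢
  omega

lemma exists_excess_lt_of_not_turanDegrees {G : SimpleGraph (Fin n)} (hG : L.Free G)
    (hn : q + m < n) (hdeg : ¬ TuranDegrees G m (q - 1)) :
    ∃ d, 1 ≤ d ∧ d ≤ m + 1 ∧ d ≤ n ∧ G.edgeSet.ncard + hPrime (n - d) (m + 1) q <
      extremalNumber (n - d) L + hPrime n (m + 1) q := by
  by_contra! hno
  refine hdeg ⟨fun v => ?_, fun S hS => ?_⟩ <;> by_contra! hlt <;>
    rw [Fintype.card_fin] at hlt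
  · exact (hno 1 le_rfl (by omega) (by omega)).not_gt
      (ncard_edgeSet_add_hPrime_lt_of_degree hG (by omega) hlt)
  · exact (hno (m + 1) (by omega) le_rfl (by omega)).not_gt
      (ncard_edgeSet_add_hPrime_lt_of_clique hG (by omega) hS hlt)

theorem eventually_extremalTuranWith (hm : 0 < m) (hL : L ≠ ⊥)
    (hmatch : L ⊑ join (starForest k 1) (completeEquipartiteGraph m s))
    (hstar : L ⊑ join (starForest (q - 1) s ⊕g (⊤ : SimpleGraph (Fin 2)))
      (completeEquipartiteGraph m s))
    (hgood : ∀ Q : SimpleGraph (Fin (q - 1)),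
      L.Free (join Q (completeEquipartiteGraph (m + 1) s)) → FamilyFree 𝓑 Q)
    (hfree : ∀ Q : SimpleGraph (Fin (q - 1)), FamilyFree 𝓑 Q →
      ∀ n, L.Free (turanWith n (m + 1) q Q))
    (hne : (familyEX (q - 1) 𝓑).Nonempty) :
    ∃ n₀, ∀ n ≥ n₀, ExtremalTuranWith L 𝓑 (m + 1) q n := by
  obtain ⟨n₁, hn₁⟩ := exists_structure m (q - 1) s k hm
  refine eventually_of_progressive (p := m + 1) (n₂ := n₁ + q + m + 1)
    (φ := fun n => extremalNumber n L - (hPrime n (m + 1) q + familyEx (q - 1) 𝓑))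
    (fun n hn => by simp [hn.extremalNumber_eq]) fun n hn hext => ?_
  have hlow := le_extremalNumber (p := m + 1) hne (by omega) fun Q hQ => hfree Q hQ n
  obtain ⟨G, hG, hdeg⟩ : ∃ G ∈ graphEX n L, ¬ TuranDegrees G m (q - 1) := by
    by_contra! hall
    refine hext (extremalTuranWith_of_forall hL hlow (fun Q hQ => hfree Q hQ n) fun G hG => ?_)
    obtain ⟨X, hX, hcol, hjoin⟩ := hn₁ n (by omega) G (fun h => hG.1 (hmatch.trans h))
      (fun h => hG.1 (hstar.trans h)) (hall G hG)
    exact ncard_edgeSet_le_hPrime_add_familyEx m.succ_pos hG.1 hgood hX hcol hjoin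
  obtain ⟨d, hd, hdm, hdn, hlt⟩ := exists_excess_lt_of_not_turanDegrees hG.1 (by omega) hdeg
  rw [hG.2] at hlt
  exact ⟨d, hd, hdm, hdn, by omega⟩

end Extremal

section JoinColorable

variable {U V W X : Type*} {L : SimpleGraph U} {H : SimpleGraph V} {K : SimpleGraph W}
  {a b m : ℕ}

/-- The associativity of the join. -/
def joinAssoc (H : SimpleGraph V) (K : SimpleGraph W) (J : SimpleGraph X) :
    join (join H K) J ≃g join H (join K J) where
  toEquiv := .sumAssoc ..
  map_rel_iff' := by rintro ((a | a) | a) ((b | b) | b) <;> simp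

lemma colorable_join (hH : H.Colorable a) (hK : K.Colorable b) : (join H K).Colorable (a + b) := by
  obtain ⟨c⟩ := hH
  obtain ⟨d⟩ := hK
  refine (Coloring.mk (Sum.map c d) ?_ : (join H K).Coloring (Fin a ⊕ Fin b)).colorable.mono ?_
  · rintro (u | u) (v | v) huv
    · exact fun h => c.valid (join_adj_inl_inl.1 huv) (Sum.inl_injective h)
    · exact Sum.inl_ne_inr
    · exact Sum.inr_ne_inl
    · exact fun h => d.valid (join_adj_inr_inr.1 huv) (Sum.inr_injective h)
  · simp

lemma turanGraph_colorable (n : ℕ) (hm : 0 < m) : (turanGraph n m).Colorable m :=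
  ⟨Coloring.mk (fun v => ⟨v % m, Nat.mod_lt _ hm⟩) fun h heq => h (Fin.mk.inj heq)⟩

lemma isContained_join_iff :
    L ⊑ join H K ↔ ∃ P : Set U, L.induce P ⊑ H ∧ L.induce Pᶜ ⊑ K := by
  constructor
  · rintro ⟨f⟩
    let P : Set U := {x | (f x).isLeft}
    have hl (x : P) : ∃ v, f x = .inl v := Sum.isLeft_iff.1 x.2
    have hr (x : ↑Pᶜ) : ∃ w, f x = .inr w := Sum.isRight_iff.1 (Sum.not_isLeft.1 x.2)
    choose g hg using hl
    choose k hk using hr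
    refine ⟨P, ⟨⟨⟨g, fun {x y} hxy => ?_⟩, fun x y hxy => Subtype.ext (f.injective ?_)⟩⟩,
      ⟨⟨⟨k, fun {x y} hxy => ?_⟩, fun x y hxy => Subtype.ext (f.injective ?_)⟩⟩⟩
    · have := f.toHom.map_adj (show L.Adj x y from hxy)
      simpa [hg] using this
    · exact (hg x).trans ((congrArg Sum.inl hxy).trans (hg y).symm)
    · have := f.toHom.map_adj (show L.Adj x y from hxy)
      simpa [hk] using this
    · exact (hk x).trans ((congrArg Sum.inr hxy).trans (hk y).symm)
  · rintro ⟨P, hP, hPc⟩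
    refine IsContained.trans ⟨⟨⟨(Equiv.Set.sumCompl P).symm, fun {x y} hxy => ?_⟩,
      (Equiv.Set.sumCompl P).symm.injective⟩⟩ (join_isContained_join hP hPc)
    obtain ⟨x | x, rfl⟩ := (Equiv.Set.sumCompl P).surjective x <;>
      obtain ⟨y | y, rfl⟩ := (Equiv.Set.sumCompl P).surjective y <;> simp_all

lemma isContained_completeEquipartiteGraph [Fintype U] (hL : L.Colorable m) {t : ℕ}
    (ht : Fintype.card U ≤ t) : L ⊑ completeEquipartiteGraph m t :=
  isContained_completeEquipartiteGraph_of_colorable hL.some t fun _ =>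
    (Fintype.card_subtype_le _).trans ht

lemma isContained_join_of_colorable [Fintype U] {P : Set U} (hP : L.induce P ⊑ H)
    (hPc : (L.induce Pᶜ).Colorable m) :
    L ⊑ join H (completeEquipartiteGraph m (Fintype.card U)) :=
  isContained_join_iff.2 ⟨P, hP,
    isContained_completeEquipartiteGraph hPc (Fintype.card_subtype_le _)⟩

lemma isContained_join_completeEquipartiteGraph [Fintype U] (h : L ⊑ join H K)
    (hK : K.Colorable m) : L ⊑ join H (completeEquipartiteGraph m (Fintype.card U)) := by
  obtain ⟨P, hP, ⟨f⟩⟩ := isContained_join_iff.1 h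
  exact isContained_join_of_colorable hP (hK.of_hom f.toHom)

lemma exists_isVertexCover_of_isContained_join (h : L ⊑ join H (⊥ : SimpleGraph W)) :
    ∃ P, L.IsVertexCover P ∧ L.induce P ⊑ H := by
  obtain ⟨P, hP, ⟨f⟩⟩ := isContained_join_iff.1 h
  exact ⟨P, isIndepSet_compl_iff_isVertexCover.1 fun u hu v hv _ huv =>
    f.toHom.map_adj (v := ⟨u, hu⟩) (w := ⟨v, hv⟩) huv, hP⟩

lemma isContained_join_bot {P : Set U} (hP : L.IsVertexCover P) (h : L.induce P ⊑ H) :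
    L ⊑ join H (⊥ : SimpleGraph U) := by
  refine isContained_join_iff.2 ⟨P, h, ⟨⟨⟨Subtype.val, fun {x y} hxy => ?_⟩,
    Subtype.val_injective⟩⟩⟩
  exact isIndepSet_compl_iff_isVertexCover.2 hP x.2 y.2 (Subtype.val_injective.ne hxy.ne) hxy

lemma sum_bot_isContained_join (h : L ⊑ join H (⊥ : SimpleGraph W)) :
    L ⊕g (⊥ : SimpleGraph X) ⊑ join H (⊥ : SimpleGraph (W ⊕ X)) := by
  obtain ⟨f⟩ := h
  refine ⟨⟨⟨Sum.elim (fun u => (f u).map id .inl) fun x => .inr (.inr x), ?_⟩, ?_⟩⟩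
  · rintro (u | x) (v | y) huv
    · have hadj := f.toHom.map_adj (sum_adj_inl.1 huv)
      simp only [Copy.toHom_apply] at hadj
      simp only [Sum.elim_inl]
      rcases hu : f u with a | a <;> rcases hv : f v with b | b <;> simp_all
    all_goals simp at huv
  · refine Function.Injective.sumElim (fun u v huv => f.injective ?_)
      (Sum.inr_injective.comp Sum.inr_injective) fun u x => ?_
    · exact Sum.map_injective.2 ⟨Function.injective_id, Sum.inl_injective⟩ huv
    · rcases f u with a | a <;> simp

end JoinColorable

section Minimal

variable {V W : Type*} {A : SimpleGraph V} {B : SimpleGraph W}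

lemma ncard_edgeSet_le_of_isContained [Finite W] (h : A ⊑ B) :
    A.edgeSet.ncard ≤ B.edgeSet.ncard := by
  obtain ⟨f⟩ := h
  exact Set.ncard_le_ncard_of_injOn (Sym2.map f)
    (fun e he => by
      induction e with
      | _ a b => exact f.toHom.map_adj he)
    (Sym2.map.injective f.injective).injOn

variable [Fintype W]

lemma isContained_symm_of_card [Fintype V] (h : A ⊑ B) (hV : Fintype.card W ≤ Fintype.card V)
    (hE : B.edgeSet.ncard ≤ A.edgeSet.ncard) : B ⊑ A := by
  obtain ⟨f⟩ := h
  have hf : Function.Bijective f :=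
    (Fintype.bijective_iff_injective_and_card f).2 ⟨f.injective,
      (Fintype.card_le_of_injective f f.injective).antisymm hV⟩
  let e : V ≃ W := Equiv.ofBijective f hf
  have hle : A.map e ≤ B := by
    change A.map e.toEmbedding ≤ B
    exact (map_le_iff_le_comap _ _ _).2 fun a b hab => f.toHom.map_adj hab
  have heq : A.map e = B := by
    refine edgeSet_inj.1 (Set.eq_of_subset_of_ncard_le (edgeSet_mono hle) ?_ (Set.toFinite _))
    rwa [← ncard_edgeSet_congr (Iso.map e A)]
  rw [← heq]
  exact (Iso.map e A).symm.isContained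

/-- A copy of a finite graph on an initial segment of the natural numbers, which makes it
comparable with the members of a `GraphFamily`. -/
noncomputable def toFin (B : SimpleGraph W) : SimpleGraph (Fin (Fintype.card W)) :=
  B.comap (Fintype.equivFin W).symm

/-- The isomorphism between a finite graph and its copy on an initial segment. -/
noncomputable def toFinIso (B : SimpleGraph W) : toFin B ≃g B :=
  ⟨(Fintype.equivFin W).symm, Iff.rfl⟩

end Minimal

section DecompositionFamily

variable {U V W : Type*} {L : SimpleGraph U} {H : SimpleGraph V} {K : SimpleGraph W} {m : ℕ}

lemma exists_mem_decompositionFamily_of_decomposes {n : ℕ} {M : SimpleGraph (Fin n)}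
    (h : Decomposes L M) : ∃ F ∈ decompositionFamily L, F.2 ⊑ M := by
  let size : (Σ n : ℕ, SimpleGraph (Fin n)) → ℕ := fun F => F.1 + F.2.edgeSet.ncard
  obtain ⟨F, ⟨hF, hFM⟩, hmin⟩ := (measure size).wf.has_min
    {F : Σ n : ℕ, SimpleGraph (Fin n) | Decomposes L F.2 ∧ F.2 ⊑ M} ⟨⟨n, M⟩, h, .refl _⟩
  refine ⟨F, ⟨hF, fun F' hF' hle => ?_⟩, hFM⟩
  have hsize : ¬ F'.1 + F'.2.edgeSet.ncard < F.1 + F.2.edgeSet.ncard :=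
    hmin F' ⟨hF', hle.trans hFM⟩
  have hcard : F'.1 ≤ F.1 := by
    obtain ⟨f⟩ := hle
    simpa using Fintype.card_le_of_injective f f.injective
  have hedges := ncard_edgeSet_le_of_isContained hle
  exact isContained_symm_of_card hle (by simp only [Fintype.card_fin]; omega) (by omega)

lemma exists_mem_decompositionFamily [Finite U] (hχ : L.chromaticNumber = (m + 2 : ℕ))
    (h : L ⊑ join H K) (hK : K.Colorable m) : ∃ F ∈ decompositionFamily L, F.2 ⊑ H := by
  have := Fintype.ofFinite U
  obtain ⟨P, hP, ⟨f⟩⟩ := isContained_join_iff.1 h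
  have hL := isContained_join_of_colorable (toFinIso (L.induce P)).symm.isContained
    (hK.of_hom f.toHom)
  obtain ⟨F, hF, hle⟩ := exists_mem_decompositionFamily_of_decomposes
    (L := L) (M := toFin (L.induce P)) ⟨0, m * Fintype.card U, by
      rw [hχ, ENat.toNat_natCast, Nat.add_sub_cancel]
      exact hL.trans (join_isContained_join Embedding.sumInl.isContained
        completeEquipartiteGraph.turanGraph.isContained)⟩
  exact ⟨F, hF, hle.trans ((toFinIso _).isContained.trans hP)⟩

lemma isContained_join_of_mem_decompositionFamily (hχ : L.chromaticNumber = (m + 2 : ℕ))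
    {F : Σ n : ℕ, SimpleGraph (Fin n)} (hF : F ∈ decompositionFamily L) :
    ∃ v t : ℕ, L ⊑ join (F.2 ⊕g (⊥ : SimpleGraph (Fin v))) (turanGraph t m) := by
  obtain ⟨v, t, h⟩ := hF.1
  rw [hχ, ENat.toNat_natCast, Nat.add_sub_cancel] at h
  exact ⟨v, t, h⟩

lemma completeEquipartiteGraph_succ_isContained (m t : ℕ) :
    completeEquipartiteGraph (m + 1) t ⊑
      join (⊥ : SimpleGraph (Fin t)) (completeEquipartiteGraph m t) := by
  refine ⟨⟨⟨fun v => Fin.cases (.inl v.2) (fun i => .inr (i, v.2)) v.1, ?_⟩, ?_⟩⟩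
  · rintro ⟨i, x⟩ ⟨j, y⟩ h
    cases i using Fin.cases <;> cases j using Fin.cases <;> simp_all
  · rintro ⟨i, x⟩ ⟨j, y⟩ h
    cases i using Fin.cases <;> cases j using Fin.cases <;> simp_all

/-- The class of the multipartite graph that is moved to the other side of the join gives the
complement of the covering. -/
lemma isContained_join_completeEquipartiteGraph_succ_iff [Fintype U] (hm : 0 < m)
    (hχ : L.chromaticNumber = (m + 2 : ℕ)) :
    L ⊑ join H (completeEquipartiteGraph (m + 1) (Fintype.card U)) ↔
      ∃ F ∈ decompositionFamily L, ∃ X, F.2.IsVertexCover X ∧ F.2.induce X ⊑ H := by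
  constructor
  · intro h
    have hL : L ⊑ join (join H (⊥ : SimpleGraph (Fin (Fintype.card U))))
        (completeEquipartiteGraph m (Fintype.card U)) :=
      (h.trans (join_isContained_join (.refl _)
        (completeEquipartiteGraph_succ_isContained ..))).trans (joinAssoc ..).symm.isContained
    obtain ⟨F, hF, hFH⟩ := exists_mem_decompositionFamily hχ hL completeEquipartiteGraph_colorable
    exact ⟨F, hF, exists_isVertexCover_of_isContained_join hFH⟩
  · rintro ⟨F, hF, X, hX, hXH⟩
    obtain ⟨v, t, hL⟩ := isContained_join_of_mem_decompositionFamily hχ hF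
    have hL' : L ⊑ join H (join (⊥ : SimpleGraph (Fin F.1 ⊕ Fin v)) (turanGraph t m)) :=
      (hL.trans (join_isContained_join (sum_bot_isContained_join (isContained_join_bot hX hXH))
        (.refl _))).trans (joinAssoc ..).isContained
    refine isContained_join_completeEquipartiteGraph hL' ?_
    rw [add_comm]
    exact colorable_join (colorable_one_iff.2 rfl) (turanGraph_colorable t hm)

end DecompositionFamily

section CoveringFamily

variable {𝓜 : GraphFamily}

lemma indepCoverNum_le {V : Type*} {F : SimpleGraph V} {X : Finset V}
    (hc : F.IsVertexCover (X : Set V)) (hi : F.IsIndepSet (X : Set V)) : indepCoverNum F ≤ #X :=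
  Nat.sInf_le ⟨X, hc, hi, rfl⟩

lemma exists_indepCover {V : Type*} [Finite V] {F : SimpleGraph V} (h : F.IsBipartite) :
    ∃ X : Finset V, F.IsVertexCover (X : Set V) ∧ F.IsIndepSet (X : Set V) ∧
      #X = indepCoverNum F := by
  have := Fintype.ofFinite V
  refine Nat.sInf_mem (s := {k | ∃ X : Finset V, F.IsVertexCover (X : Set V) ∧
    F.IsIndepSet (X : Set V) ∧ X.card = k}) ?_
  obtain ⟨c⟩ := h
  refine ⟨_, univ.filter fun v => c v = 0, fun u v huv => ?_, fun u hu v hv _ huv => ?_, rfl⟩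
  · have := c.valid huv
    simp only [coe_filter, mem_univ, true_and, Set.mem_ofPred_eq]
    omega
  · simp only [coe_filter, mem_univ, true_and, Set.mem_ofPred_eq] at hu hv
    exact c.valid huv (hu.trans hv.symm)

lemma isBipartite_of_indepCover {V : Type*} {F : SimpleGraph V} {X : Set V}
    (hc : F.IsVertexCover X) (hi : F.IsIndepSet X) : F.IsBipartite := by
  refine ⟨Coloring.mk (fun v => if v ∈ X then 0 else 1) fun {u v} huv => ?_⟩
  have := hc huv
  have : u ∈ X → v ∉ X := fun hu hv => hi hu hv huv.ne huv
  split_ifs <;> simp <;> tauto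

lemma familyIndepCoverNum_le {F : Σ m : ℕ, SimpleGraph (Fin m)} (hF : F ∈ 𝓜)
    {X : Finset (Fin F.1)} (hc : F.2.IsVertexCover (X : Set (Fin F.1)))
    (hi : F.2.IsIndepSet (X : Set (Fin F.1))) : familyIndepCoverNum 𝓜 ≤ #X :=
  le_trans (Nat.sInf_le ⟨F, hF, isBipartite_of_indepCover hc hi, rfl⟩) (indepCoverNum_le hc hi)

lemma exists_indepCover_family (h : ∃ F ∈ 𝓜, F.2.IsBipartite) :
    ∃ F ∈ 𝓜, ∃ X : Finset (Fin F.1), F.2.IsVertexCover (X : Set (Fin F.1)) ∧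
      F.2.IsIndepSet (X : Set (Fin F.1)) ∧ #X = familyIndepCoverNum 𝓜 := by
  obtain ⟨F₀, hF₀, hb₀⟩ := h
  obtain ⟨F, hF, hb, hq⟩ := Nat.sInf_mem
    (s := {k | ∃ F ∈ 𝓜, F.2.IsBipartite ∧ indepCoverNum F.2 = k}) ⟨_, F₀, hF₀, hb₀, rfl⟩
  obtain ⟨X, hc, hi, hX⟩ := exists_indepCover hb
  exact ⟨F, hF, X, hc, hi, hX.trans hq⟩

/-- Coverings with at least `q` vertices need not be excluded, and neither does `K_q`, since `Q`
has only `q - 1` vertices. -/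
lemma familyFree_coveringFamily_iff (hq : 0 < familyIndepCoverNum 𝓜)
    {Q : SimpleGraph (Fin (familyIndepCoverNum 𝓜 - 1))} :
    FamilyFree (coveringFamily 𝓜) Q ↔
      ∀ F ∈ 𝓜, ∀ X, F.2.IsVertexCover X → ¬ F.2.induce X ⊑ Q := by
  constructor
  · intro h F hF X hX hXQ
    have hcard : #X.toFinset < familyIndepCoverNum 𝓜 := by
      obtain ⟨f⟩ := hXQ
      have := Fintype.card_le_of_injective f f.injective
      rw [Fintype.card_fin, ← Set.toFinset_card] at this
      omega
    have hsmall : ∃ F ∈ 𝓜, F.2.vertexCoverNum < (familyIndepCoverNum 𝓜 : ℕ∞) := by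
      refine ⟨F, hF, hX.vertexCoverNum_le.trans_lt ?_⟩
      rw [Set.encard_eq_coe_toFinset_card]
      exact_mod_cast hcard
    refine h ⟨_, toFin (F.2.induce X)⟩ ?_ ((toFinIso _).isContained.trans hXQ)
    rw [coveringFamily, if_pos hsmall]
    refine ⟨F, hF, X.toFinset, by simpa, hcard, ?_⟩
    rw [Set.coe_toFinset]
    exact ⟨toFinIso _⟩
  · intro h B hB hBQ
    rw [coveringFamily] at hB
    split_ifs at hB with hsmall
    · obtain ⟨F, hF, X, hX, -, ⟨e⟩⟩ := hB
      exact h F hF X hX (e.symm.isContained.trans hBQ)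
    · obtain rfl := Set.mem_singleton_iff.1 hB
      obtain ⟨f⟩ := hBQ
      have := Fintype.card_le_of_injective f f.injective
      simp only [Fintype.card_fin] at this
      omega

lemma familyFree_coveringFamily_bot (hq : 0 < familyIndepCoverNum 𝓜) :
    FamilyFree (coveringFamily 𝓜) (⊥ : SimpleGraph (Fin (familyIndepCoverNum 𝓜 - 1))) := by
  refine (familyFree_coveringFamily_iff hq).2 fun F hF X hX ⟨f⟩ => ?_
  have hind : F.2.IsIndepSet X := fun u hu v hv _ huv =>
    f.toHom.map_adj (v := ⟨u, hu⟩) (w := ⟨v, hv⟩) huv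
  have hle := familyIndepCoverNum_le (X := X.toFinset) hF (by simpa) (by simpa)
  have := Fintype.card_le_of_injective f f.injective
  rw [Fintype.card_fin, ← Set.toFinset_card] at this
  omega

lemma free_join_iff_familyFree_coveringFamily {U : Type*} [Fintype U] {L : SimpleGraph U} {m : ℕ}
    (hm : 0 < m) (hχ : L.chromaticNumber = (m + 2 : ℕ))
    (hq : 0 < familyIndepCoverNum (decompositionFamily L))
    {Q : SimpleGraph (Fin (familyIndepCoverNum (decompositionFamily L) - 1))} :
    L.Free (join Q (completeEquipartiteGraph (m + 1) (Fintype.card U))) ↔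
      FamilyFree (coveringFamily (decompositionFamily L)) Q := by
  rw [SimpleGraph.Free, isContained_join_completeEquipartiteGraph_succ_iff hm hχ,
    familyFree_coveringFamily_iff hq]
  push Not
  rfl

end CoveringFamily

section Blowup

variable {V W : Type*} {T : SimpleGraph V} {A : Set V} {C : Finset V} {k m : ℕ}

lemma adj_of_mem_edge {e : T.edgeSet} {u v : V} (hu : u ∈ (e : Sym2 V)) (hv : v ∈ (e : Sym2 V))
    (h : u ≠ v) : T.Adj u v := by
  have he := e.2
  rwa [(Sym2.mem_and_mem_iff h).1 ⟨hu, hv⟩, mem_edgeSet] at he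

lemma eq_of_mem_edge {S : Set V} (hS : T.IsIndepSet S) {e : T.edgeSet} {u v : V}
    (hu : u ∈ (e : Sym2 V)) (hv : v ∈ (e : Sym2 V)) (huS : u ∈ S) (hvS : v ∈ S) : u = v := by
  by_contra h
  exact hS huS hvS h (adj_of_mem_edge hu hv h)

@[simp] lemma inl_mem_blowupClique {e : T.edgeSet} {v : V} :
    .inl v ∈ blowupClique T k e ↔ v ∈ (e : Sym2 V) := by
  simp [blowupClique]

@[simp] lemma inr_mem_blowupClique {e e' : T.edgeSet} {i : Fin (k - 2)} :
    .inr (e', i) ∈ blowupClique T k e ↔ e' = e := by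
  simp only [blowupClique, Set.mem_ofPred_eq, reduceCtorEq, and_false, exists_false, false_or,
    Sum.inr.injEq, Prod.mk.injEq, exists_and_left, exists_eq', and_true]

@[simp] lemma edgeBlowup_adj_inl_inl {u v : V} :
    (edgeBlowup T k).Adj (.inl u) (.inl v) ↔ T.Adj u v := by
  simp only [edgeBlowup, inl_mem_blowupClique, ne_eq, Sum.inl.injEq]
  exact ⟨fun ⟨hne, e, hu, hv⟩ => adj_of_mem_edge hu hv hne,
    fun h => ⟨h.ne, ⟨s(u, v), h⟩, Sym2.mem_mk_left _ _, Sym2.mem_mk_right _ _⟩⟩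

@[simp] lemma edgeBlowup_adj_inl_inr {v : V} {e : T.edgeSet} {i : Fin (k - 2)} :
    (edgeBlowup T k).Adj (.inl v) (.inr (e, i)) ↔ v ∈ (e : Sym2 V) := by
  simp [edgeBlowup]

@[simp] lemma edgeBlowup_adj_inr_inr {e e' : T.edgeSet} {i j : Fin (k - 2)} :
    (edgeBlowup T k).Adj (.inr (e, i)) (.inr (e', j)) ↔ e = e' ∧ i ≠ j := by
  simp only [edgeBlowup, inr_mem_blowupClique, ne_eq, Sum.inr.injEq, Prod.mk.injEq]
  constructor
  · rintro ⟨h, e'', rfl, rfl⟩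
    exact ⟨rfl, fun hij => h ⟨rfl, hij⟩⟩
  · rintro ⟨rfl, h⟩
    exact ⟨fun h' => h h'.2, e, rfl, rfl⟩

lemma exists_isNClique_subset_blowupClique (m : ℕ) (e : T.edgeSet) :
    ∃ K : Finset (V ⊕ T.edgeSet × Fin (m + 2 - 2)),
      (edgeBlowup T (m + 2)).IsNClique (m + 2) K ∧ ↑K ⊆ blowupClique T (m + 2) e := by
  obtain ⟨⟨⟨a, b⟩, hab⟩, rfl⟩ : ∃ e' : T.edgeSet, e' = e := ⟨e, rfl⟩
  let vertex : Fin 2 ⊕ Fin m → V ⊕ T.edgeSet × Fin (m + 2 - 2) :=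
    Sum.map ![a, b] fun i => (⟨s(a, b), hab⟩, i)
  have hinj : Function.Injective vertex := by
    refine Sum.map_injective.2 ⟨(edgeCopy hab).injective, fun i j h => (Prod.mk.inj h).2⟩
  have hmem (x) : vertex x ∈ blowupClique T (m + 2) ⟨s(a, b), hab⟩ := by
    rcases x with x | i
    · fin_cases x <;> simp [vertex]
    · simp [vertex]
  refine ⟨univ.map ⟨vertex, hinj⟩, ⟨?_, by simp [add_comm]⟩, ?_⟩
  swap
  · rintro _ h
    obtain ⟨x, -, rfl⟩ := mem_map.1 h
    exact hmem x
  simp only [coe_map, Function.Embedding.coeFn_mk, coe_univ, Set.image_univ]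
  rintro _ ⟨x, rfl⟩ _ ⟨y, rfl⟩ hne
  exact ⟨hne, _, hmem x, hmem y⟩

lemma exists_ne_mem_of_colorable_compl {G : SimpleGraph W} {K : Finset W} {S : Set W}
    (hK : G.IsNClique (m + 2) K) (hS : (G.induce Sᶜ).Colorable m) :
    ∃ x ∈ K, ∃ y ∈ K, x ∈ S ∧ y ∈ S ∧ x ≠ y := by
  have hout : #{x ∈ K | x ∉ S} ≤ m := by
    refine le_of_eq_of_le (Nat.card_eq_finsetCard _).symm
      (hS.card_le_of_pairwise_adj (ι := ↥{x ∈ K | x ∉ S})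
        (fun x => ⟨x, (mem_filter.1 x.2).2⟩) fun x y hxy => ?_)
    exact hK.isClique (mem_filter.1 x.2).1 (mem_filter.1 y.2).1 (Subtype.val_injective.ne hxy)
  have hin : 1 < #{x ∈ K | x ∈ S} := by
    have := card_filter_add_card_filter_not (s := K) (· ∈ S)
    have := hK.card_eq
    omega
  obtain ⟨x, hx, y, hy, hxy⟩ := one_lt_card.1 hin
  rw [mem_filter] at hx hy
  exact ⟨x, hx.1, y, hy.1, hx.2, hy.2, hxy⟩

/-- The vertices of the blow-up that are split off from an `m`-partite remainder: the vertices of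
`C`, the first new vertex of every clique, and the second new vertex of the cliques on edges that
`C` does not cover. -/
def splitSet (T : SimpleGraph V) (m : ℕ) (C : Finset V) : Set (V ⊕ T.edgeSet × Fin (m + 2 - 2)) :=
  {x | Sum.elim (· ∈ C)
    (fun y => (y.2 : ℕ) = 0 ∨ (y.2 : ℕ) = 1 ∧ ∀ v ∈ (y.1 : Sym2 V), v ∉ C) x}

@[simp] lemma inl_mem_splitSet {v : V} : .inl v ∈ splitSet T m C ↔ v ∈ C := Iff.rfl

@[simp] lemma inr_mem_splitSet {e : T.edgeSet} {i : Fin (m + 2 - 2)} :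
    .inr (e, i) ∈ splitSet T m C ↔ (i : ℕ) = 0 ∨ (i : ℕ) = 1 ∧ ∀ v ∈ (e : Sym2 V), v ∉ C :=
  Iff.rfl

/-- The role of a vertex of `splitSet T m C` in the star forest induced there: a centre, or the
leaf belonging to an edge of `T`. -/
def splitRole : V ⊕ T.edgeSet × Fin (m + 2 - 2) → (V ⊕ T.edgeSet) ⊕ T.edgeSet :=
  Sum.elim (fun v => .inl (.inl v)) fun y => if (y.2 : ℕ) = 0 then .inr y.1 else .inl (.inr y.1)

lemma injOn_splitRole : Set.InjOn splitRole (splitSet T m C) := by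
  rintro (u | ⟨e, i⟩) hx (v | ⟨e', j⟩) hy hxy <;>
    simp only [splitRole, Sum.elim_inl, Sum.elim_inr, inr_mem_splitSet] at hx hy hxy <;> grind

lemma mem_iff_notMem_of_adj (hA : T.IsBipartiteWith A Aᶜ) {u v : V} (huv : T.Adj u v) :
    u ∈ A ↔ v ∉ A := by
  rcases hA.mem_of_adj huv with ⟨hu, hv⟩ | ⟨hu, hv⟩
  · exact iff_of_true hu hv
  · exact iff_of_false hu (not_not.2 hv)

/-- A colour for each vertex of the blow-up outside `splitSet T m C`. The second new vertex of a
clique whose edge has an end in `C` takes over the colour that this end has in the 2-colouring of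
`T`. -/
noncomputable def splitColor (T : SimpleGraph V) (m : ℕ) (A : Set V) (C : Finset V) :
    V ⊕ T.edgeSet × Fin (m + 2 - 2) → ℕ :=
  Sum.elim (fun v => if v ∈ A then 0 else 1)
    fun y => if (y.2 : ℕ) = 1 ∧ ∃ w ∈ (y.1 : Sym2 V), w ∈ C ∧ w ∈ A then 0 else y.2

lemma splitColor_inl_ne_splitColor_inr (hA : T.IsBipartiteWith A Aᶜ)
    (hC : T.IsIndepSet (C : Set V)) {v : V} {e : T.edgeSet} {i : Fin (m + 2 - 2)}
    (hve : v ∈ (e : Sym2 V)) (hv : .inl v ∉ splitSet T m C) (hi : .inr (e, i) ∉ splitSet T m C) :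
    splitColor T m A C (.inl v) ≠ splitColor T m A C (.inr (e, i)) := by
  simp only [inl_mem_splitSet, inr_mem_splitSet, not_or, not_and, not_forall, not_not] at hv hi
  simp only [splitColor, Sum.elim_inl, Sum.elim_inr]
  by_cases h1 : (i : ℕ) = 1
  · obtain ⟨w, hwe, hwC⟩ := hi.2 h1
    have hvw := mem_iff_notMem_of_adj hA (adj_of_mem_edge hve hwe (by rintro rfl; exact hv hwC))
    have hex : (∃ w ∈ (e : Sym2 V), w ∈ C ∧ w ∈ A) ↔ w ∈ A :=
      ⟨fun ⟨u, hu, huC, huA⟩ => eq_of_mem_edge hC hwe hu hwC huC ▸ huA, fun h => ⟨w, hwe, hwC, h⟩⟩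
    by_cases hw : w ∈ A <;> simp [h1, hex, hvw, hw]
  · have := hi.1
    simp only [h1, false_and, if_false]
    split_ifs <;> omega

lemma colorable_compl_splitSet (hm : 2 ≤ m) (hA : T.IsBipartiteWith A Aᶜ)
    (hC : T.IsIndepSet (C : Set V)) :
    ((edgeBlowup T (m + 2)).induce (splitSet T m C)ᶜ).Colorable m := by
  refine (colorable_iff_exists_bdd_nat_coloring m).2
    ⟨.mk (fun x => splitColor T m A C x.1) ?_, ?_⟩
  · rintro ⟨u | ⟨e, i⟩, hx⟩ ⟨v | ⟨e', j⟩, hy⟩ (hxy : (edgeBlowup T (m + 2)).Adj _ _)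
    · have := mem_iff_notMem_of_adj hA (edgeBlowup_adj_inl_inl.1 hxy)
      by_cases hv : v ∈ A <;> simp [splitColor, this, hv]
    · exact splitColor_inl_ne_splitColor_inr hA hC (edgeBlowup_adj_inl_inr.1 hxy) hx hy
    · exact (splitColor_inl_ne_splitColor_inr hA hC (edgeBlowup_adj_inl_inr.1 hxy.symm) hy hx).symm
    · obtain ⟨rfl, hij⟩ := edgeBlowup_adj_inr_inr.1 hxy
      have hi : (i : ℕ) ≠ 0 := fun h => hx (.inl h)
      have hj : (j : ℕ) ≠ 0 := fun h => hy (.inl h)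
      have hij := Fin.val_ne_of_ne hij
      simp only [splitColor, Sum.elim_inr]
      split_ifs <;> omega
  · rintro ⟨u | ⟨e, i⟩, hx⟩
    · change splitColor T m A C (.inl u) < m
      simp only [splitColor, Sum.elim_inl]
      split_ifs <;> omega
    · change splitColor T m A C (.inr (e, i)) < m
      have := i.isLt
      simp only [splitColor, Sum.elim_inr]
      split_ifs <;> omega

end Blowup

section StarCenters

variable {V W : Type*} [Fintype V] {T : SimpleGraph V} {C : Finset V} {m : ℕ}

/-- The centres of the star forest induced on `splitSet T m C`: the vertices of `C`, and one centre
for each edge not covered by `C`, representing the second new vertex of its clique. -/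
noncomputable def starCenters (T : SimpleGraph V) (C : Finset V) : Finset (V ⊕ T.edgeSet) :=
  C.disjSum {e | ∀ v ∈ (e : Sym2 V), v ∉ C}

@[simp] lemma inl_mem_starCenters {v : V} : .inl v ∈ starCenters T C ↔ v ∈ C := inl_mem_disjSum

@[simp] lemma inr_mem_starCenters {e : T.edgeSet} :
    .inr e ∈ starCenters T C ↔ ∀ v ∈ (e : Sym2 V), v ∉ C := by
  simp [starCenters]

/-- The centre of the star that contains the first new vertex of the clique on `e`. -/
noncomputable def starCenter (C : Finset V) (e : T.edgeSet) : V ⊕ T.edgeSet :=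
  if h : ∃ v ∈ (e : Sym2 V), v ∈ C then .inl h.choose else .inr e

lemma starCenter_mem (C : Finset V) (e : T.edgeSet) : starCenter C e ∈ starCenters T C := by
  rw [starCenter]
  split_ifs with h
  · exact inl_mem_starCenters.2 h.choose_spec.2
  · simpa using h

lemma mem_of_starCenter_eq_inl {e : T.edgeSet} {v : V} (h : starCenter C e = .inl v) :
    v ∈ (e : Sym2 V) := by
  rw [starCenter] at h
  split_ifs at h with he
  exact Sum.inl_injective h ▸ he.choose_spec.1

lemma starCenter_eq_inl (hC : T.IsIndepSet (C : Set V)) {e : T.edgeSet} {v : V}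
    (hve : v ∈ (e : Sym2 V)) (hv : v ∈ C) : starCenter C e = .inl v := by
  have h : ∃ v ∈ (e : Sym2 V), v ∈ C := ⟨v, hve, hv⟩
  rw [starCenter, dif_pos h, eq_of_mem_edge hC h.choose_spec.1 hve h.choose_spec.2 hv]

lemma starCenter_eq_inr_iff {e e' : T.edgeSet} :
    starCenter C e = .inr e' ↔ e = e' ∧ ∀ v ∈ (e : Sym2 V), v ∉ C := by
  rw [starCenter]
  split_ifs with h
  · simpa using fun _ => h
  · simpa using fun _ => by simpa using h

lemma mem_starCenters_of_splitRole_eq_inl {x : V ⊕ T.edgeSet × Fin (m + 2 - 2)}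
    (hx : x ∈ splitSet T m C) {j : V ⊕ T.edgeSet} (h : splitRole x = .inl j) :
    j ∈ starCenters T C := by
  rcases x with v | ⟨e, i⟩
  · exact Sum.inl_injective h ▸ inl_mem_starCenters.2 hx
  · simp only [splitRole, Sum.elim_inr] at h
    split_ifs at h with hi
    exact Sum.inl_injective h ▸ inr_mem_starCenters.2 ((inr_mem_splitSet.1 hx).resolve_left hi).2

lemma splitRole_of_adj (hC : T.IsIndepSet (C : Set V)) {x y : V ⊕ T.edgeSet × Fin (m + 2 - 2)}
    (hx : x ∈ splitSet T m C) (hy : y ∈ splitSet T m C) (hxy : (edgeBlowup T (m + 2)).Adj x y) :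
    ∃ e, splitRole x = .inl (starCenter C e) ∧ splitRole y = .inr e ∨
      splitRole y = .inl (starCenter C e) ∧ splitRole x = .inr e := by
  have hmixed {v : V} {e : T.edgeSet} {i : Fin (m + 2 - 2)} (hv : .inl v ∈ splitSet T m C)
      (hi : .inr (e, i) ∈ splitSet T m C)
      (h : (edgeBlowup T (m + 2)).Adj (.inl v) (.inr (e, i))) :
      splitRole (T := T) (m := m) (.inl v) = .inl (starCenter C e) ∧
        splitRole (.inr (e, i)) = .inr e := by
    have hve := edgeBlowup_adj_inl_inr.1 h
    have hi0 : (i : ℕ) = 0 := (inr_mem_splitSet.1 hi).resolve_right fun h' => h'.2 v hve hv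
    exact ⟨congrArg _ (starCenter_eq_inl hC hve hv).symm, if_pos hi0⟩
  rcases x with u | ⟨e, i⟩ <;> rcases y with v | ⟨e', j⟩
  · exact absurd (edgeBlowup_adj_inl_inl.1 hxy) (hC hx hy (by rintro rfl; exact hxy.ne rfl))
  · exact ⟨e', .inl (hmixed hx hy hxy)⟩
  · exact ⟨e, .inr (hmixed hy hx hxy.symm)⟩
  · obtain ⟨rfl, hij⟩ := edgeBlowup_adj_inr_inr.1 hxy
    have hij := Fin.val_ne_of_ne hij
    rw [inr_mem_splitSet] at hx hy
    refine ⟨e, ?_⟩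
    rcases hx with hi | ⟨hi, he⟩
    · have hj := hy.resolve_left (hi ▸ hij.symm)
      rw [starCenter_eq_inr_iff.2 ⟨rfl, hj.2⟩]
      simp [splitRole, hi, hj.1]
    · have hj := hy.resolve_right fun h => hij (hi.trans h.1.symm)
      rw [starCenter_eq_inr_iff.2 ⟨rfl, he⟩]
      simp [splitRole, hi, hj]

lemma induce_splitSet_isContained {H : SimpleGraph W} (hC : T.IsIndepSet (C : Set V))
    {center : V ⊕ T.edgeSet → W} {leaf : T.edgeSet → W}
    (hcenter : Set.InjOn center (starCenters T C)) (hleaf : Function.Injective leaf)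
    (hne : ∀ j e, center j ≠ leaf e) (hadj : ∀ e, H.Adj (center (starCenter C e)) (leaf e)) :
    (edgeBlowup T (m + 2)).induce (splitSet T m C) ⊑ H := by
  refine ⟨⟨⟨fun x => Sum.elim center leaf (splitRole x.1), fun {x y} hxy => ?_⟩, ?_⟩⟩
  · obtain ⟨e, ⟨hx, hy⟩ | ⟨hy, hx⟩⟩ := splitRole_of_adj hC x.2 y.2 hxy <;>
      simp only [hx, hy, Sum.elim_inl, Sum.elim_inr]
    exacts [hadj e, (hadj e).symm]
  · rintro ⟨x, hx⟩ ⟨y, hy⟩ (hxy : Sum.elim center leaf _ = Sum.elim center leaf _)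
    refine Subtype.ext (injOn_splitRole hx hy ?_)
    rcases hjx : splitRole x with j | e <;> rcases hjy : splitRole y with j' | e' <;>
      rw [hjx, hjy] at hxy
    · exact congrArg _ (hcenter (mem_starCenters_of_splitRole_eq_inl hx hjx)
        (mem_starCenters_of_splitRole_eq_inl hy hjy) hxy)
    · exact absurd hxy (hne _ _)
    · exact absurd hxy.symm (hne _ _)
    · exact congrArg _ (hleaf hxy)

end StarCenters

section BlowupContainment

variable {V : Type*} [Fintype V] {T : SimpleGraph V} {A : Set V} {C : Finset V} {m r : ℕ}

lemma edgeBlowup_isContained_join_matching (hm : 2 ≤ m) (hA : T.IsBipartiteWith A Aᶜ) :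
    edgeBlowup T (m + 2) ⊑ join (starForest (Fintype.card (V ⊕ T.edgeSet)) 1)
      (completeEquipartiteGraph m (Fintype.card (V ⊕ T.edgeSet × Fin (m + 2 - 2)))) := by
  have hC : T.IsIndepSet ((∅ : Finset V) : Set V) := by simp
  let ι := Fintype.equivFin (V ⊕ T.edgeSet)
  refine isContained_join_of_colorable (induce_splitSet_isContained hC
    (center := fun j => (ι j, none)) (leaf := fun e => (ι (.inr e), some 0)) ?_ ?_ ?_ fun e => ?_)
    (colorable_compl_splitSet hm hA hC)
  · exact fun _ _ _ _ h => ι.injective (congrArg Prod.fst h)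
  · exact fun _ _ h => Sum.inr_injective (ι.injective (congrArg Prod.fst h))
  · simp
  · rw [starCenter_eq_inr_iff.2 ⟨rfl, by simp⟩]
    simp [starForest]

lemma exists_injOn_eq_none {α : Type*} {J : Finset α} (hJ : #J ≤ r + 1) (j₀ : α) :
    ∃ idx : α → Option (Fin r), Set.InjOn idx J ∧ idx j₀ = none := by
  have hcard : Fintype.card J ≤ Fintype.card (Option (Fin r)) := by simpa using hJ
  obtain ⟨f⟩ := Function.Embedding.nonempty_of_card_le hcard
  obtain ⟨g, hg⟩ := Set.exists_injOn_iff_injective.2 ⟨f, f.injective⟩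
  exact ⟨Equiv.swap (g j₀) none ∘ g, (Equiv.injective _).comp_injOn hg, Equiv.swap_apply_left _ _⟩

/-- By `hsingle`, the star at `j₀` has at most one edge, so the extra `K₂` can play its role. -/
lemma edgeBlowup_isContained_join_starForest (hm : 2 ≤ m) (hA : T.IsBipartiteWith A Aᶜ)
    (hC : T.IsIndepSet (C : Set V)) (hr : #(starCenters T C) ≤ r + 1) {j₀ : V ⊕ T.edgeSet}
    (hj₀ : j₀ ∈ starCenters T C) (hsingle : (starCenter C ⁻¹' {j₀}).Subsingleton) :
    edgeBlowup T (m + 2) ⊑ join (starForest r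
        (Fintype.card (V ⊕ T.edgeSet × Fin (m + 2 - 2))) ⊕g (⊤ : SimpleGraph (Fin 2)))
      (completeEquipartiteGraph m (Fintype.card (V ⊕ T.edgeSet × Fin (m + 2 - 2)))) := by
  obtain ⟨idx, hidx, hidx₀⟩ := exists_injOn_eq_none hr j₀
  have hnone {j} (hj : j ∈ starCenters T C) (h : idx j = none) : j = j₀ :=
    hidx hj hj₀ (h.trans hidx₀.symm)
  let leafIdx (e : T.edgeSet) : Fin (Fintype.card (V ⊕ T.edgeSet × Fin (m + 2 - 2))) :=
    Fintype.equivFin _ (.inr (e, ⟨0, by omega⟩))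
  refine isContained_join_of_colorable (induce_splitSet_isContained hC
    (center := fun j => (idx j).elim (.inr 0) fun a => .inl (a, none))
    (leaf := fun e => (idx (starCenter C e)).elim (.inr 1) fun a => .inl (a, some (leafIdx e)))
    ?_ ?_ ?_ fun e => ?_) (colorable_compl_splitSet hm hA hC)
  · intro j hj j' hj' h
    refine hidx hj hj' ?_
    rcases h1 : idx j with _ | a <;> rcases h2 : idx j' with _ | b <;> simp_all
  · intro e e' h
    rcases h1 : idx (starCenter C e) with _ | a <;> rcases h2 : idx (starCenter C e') with _ | b <;>
      simp only [h1, h2, Option.elim_none, Option.elim_some, reduceCtorEq] at h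
    · exact hsingle (hnone (starCenter_mem C e) h1) (hnone (starCenter_mem C e') h2)
    · simpa [leafIdx] using (Prod.mk.inj (Sum.inl_injective h)).2
  · intro j e
    rcases idx j with _ | a <;> rcases idx (starCenter C e) with _ | b <;> simp
  · rcases idx (starCenter C e) with _ | a <;> simp [starForest]

lemma starForest_isBipartite (r s : ℕ) : (starForest r s).IsBipartite := by
  refine (Coloring.mk (G := starForest r s) (fun a => a.2.isNone) ?_).colorable
  rintro ⟨i, _ | a⟩ ⟨j, _ | b⟩ ⟨-, h⟩ <;> simp_all

end BlowupContainment

lemma chromaticNumber_edgeBlowup {V : Type*} [Finite V] {T : SimpleGraph V} {A : Set V} {m : ℕ}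
    (hm : 2 ≤ m) (hA : T.IsBipartiteWith A Aᶜ) (e : T.edgeSet) :
    (edgeBlowup T (m + 2)).chromaticNumber = (m + 2 : ℕ) := by
  have := Fintype.ofFinite V
  refine le_antisymm ?_ ?_
  · obtain ⟨f⟩ := edgeBlowup_isContained_join_matching hm hA
    have h := (colorable_join (starForest_isBipartite _ _)
      completeEquipartiteGraph_colorable).of_hom f.toHom
    exact (add_comm 2 m ▸ h).chromaticNumber_le
  · obtain ⟨K, hK, -⟩ := exists_isNClique_subset_blowupClique m e
    simpa only [hK.card_eq] using hK.isClique.card_le_chromaticNumber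

section IndepCover

variable {U V W : Type*} {T : SimpleGraph V} {A : Set V} {C : Finset V} {k m : ℕ}

lemma exists_indepSet_of_induce_isContained {L : SimpleGraph U} {F : SimpleGraph W} {P : Set U}
    {X : Finset W} (h : L.induce P ⊑ F) (hXc : F.IsVertexCover X) (hXi : F.IsIndepSet X) :
    ∃ Y : Finset U, L.IsIndepSet Y ∧ #Y ≤ #X ∧ ∀ x ∈ P, ∀ y ∈ P, L.Adj x y → x ∈ Y ∨ y ∈ Y := by
  obtain ⟨f⟩ := h
  refine ⟨(X.preimage f f.injective.injOn).map (.subtype _), ?_, ?_, fun x hx y hy hxy => ?_⟩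
  · intro x hx y hy _ hxy
    obtain ⟨⟨x, hxP⟩, hxX, rfl⟩ := mem_map.1 hx
    obtain ⟨⟨y, hyP⟩, hyX, rfl⟩ := mem_map.1 hy
    have hf : F.Adj _ _ := f.toHom.map_adj (show (L.induce P).Adj ⟨x, hxP⟩ ⟨y, hyP⟩ from hxy)
    exact hXi (mem_preimage.1 hxX) (mem_preimage.1 hyX) hf.ne hf
  · rw [card_map]
    exact card_le_card_of_injOn f (fun _ => mem_preimage.1) f.injective.injOn
  · have hf : F.Adj _ _ := f.toHom.map_adj (show (L.induce P).Adj ⟨x, hx⟩ ⟨y, hy⟩ from hxy)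
    refine (hXc hf).imp (fun h => ?_) fun h => ?_
    exacts [mem_map.2 ⟨⟨x, hx⟩, mem_preimage.2 h, rfl⟩, mem_map.2 ⟨⟨y, hy⟩, mem_preimage.2 h, rfl⟩]

lemma isVertexCover_sum_bot {F : SimpleGraph V} {X : Finset V} (h : F.IsVertexCover X) :
    (F ⊕g (⊥ : SimpleGraph W)).IsVertexCover (X.map .inl : Finset (V ⊕ W)) := by
  rintro (a | a) (b | b) hab
  · simpa using h (sum_adj_inl.1 hab)
  all_goals simp at hab

lemma isIndepSet_sum {F : SimpleGraph V} {X : Finset V} (h : F.IsIndepSet X) (H : SimpleGraph W) :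
    (F ⊕g H).IsIndepSet (X.map .inl : Finset (V ⊕ W)) := by
  intro x hx y hy hne
  obtain ⟨x, hxX, rfl⟩ := mem_map.1 hx
  obtain ⟨y, hyX, rfl⟩ := mem_map.1 hy
  exact fun hxy => h hxX hyX (by rintro rfl; exact hne rfl) (sum_adj_inl.1 hxy)

lemma exists_indepSet_of_meets_blowupClique [Fintype V]
    {Y : Finset (V ⊕ T.edgeSet × Fin (k - 2))} (hY : (edgeBlowup T k).IsIndepSet Y)
    (hmeet : ∀ e, ∃ x ∈ Y, x ∈ blowupClique T k e) :
    ∃ C : Finset V, T.IsIndepSet (C : Set V) ∧ #(starCenters T C) ≤ #Y := by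
  refine ⟨Y.toLeft, ?_, (card_le_card ?_).trans
    (card_image_le (f := Sum.map id Prod.fst) (s := Y))⟩
  · intro u hu v hv hne huv
    exact hY (mem_toLeft.1 hu) (mem_toLeft.1 hv) (Sum.inl_injective.ne hne)
      (edgeBlowup_adj_inl_inl.2 huv)
  · rintro (v | e) hj
    · exact mem_image.2 ⟨.inl v, by simpa using hj, rfl⟩
    · obtain ⟨v | ⟨e', i⟩, hx, hxe⟩ := hmeet e
      · exact absurd hx (by simpa using inr_mem_starCenters.1 hj v (inl_mem_blowupClique.1 hxe))
      · exact mem_image.2 ⟨_, hx, congrArg _ (inr_mem_blowupClique.1 hxe)⟩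

lemma exists_indepSet_of_indepCover [Fintype V] {v t : ℕ} (hm : 0 < m) {F : SimpleGraph W}
    {X : Finset W} (hXc : F.IsVertexCover X) (hXi : F.IsIndepSet X)
    (h : edgeBlowup T (m + 2) ⊑ join (F ⊕g (⊥ : SimpleGraph (Fin v))) (turanGraph t m)) :
    ∃ C : Finset V, T.IsIndepSet (C : Set V) ∧ #(starCenters T C) ≤ #X := by
  obtain ⟨P, hP, ⟨g⟩⟩ := isContained_join_iff.1 h
  obtain ⟨Y, hYi, hYX, hYc⟩ := exists_indepSet_of_induce_isContained hP
    (isVertexCover_sum_bot hXc) (isIndepSet_sum hXi _)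
  refine (exists_indepSet_of_meets_blowupClique hYi fun e => ?_).imp fun C hC =>
    ⟨hC.1, hC.2.trans (hYX.trans (card_map _).le)⟩
  obtain ⟨K, hK, hKe⟩ := exists_isNClique_subset_blowupClique m e
  obtain ⟨x, hx, y, hy, hxP, hyP, hxy⟩ :=
    exists_ne_mem_of_colorable_compl hK ((turanGraph_colorable t hm).of_hom g.toHom)
  rcases hYc x hxP y hyP (hK.isClique hx hy hxy) with h | h
  exacts [⟨x, h, hKe hx⟩, ⟨y, h, hKe hy⟩]

lemma exists_ncard_neighborSet_eq_one (hδ : minDegreeOn T A = 1) :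
    ∃ v ∈ A, (T.neighborSet v).ncard = 1 := by
  have hne : ((fun x => (T.neighborSet x).ncard) '' A).Nonempty :=
    Nat.nonempty_of_pos_sInf (one_pos.trans_eq hδ.symm)
  obtain ⟨v, hv, h⟩ := Nat.sInf_mem hne
  exact ⟨v, hv, h.trans hδ⟩

lemma eq_or_eq_compl_of_isBipartiteWith (hT : T.Connected) {S : Set V}
    (hA : T.IsBipartiteWith A Aᶜ) (hS : T.IsBipartiteWith S Sᶜ) : S = A ∨ S = Aᶜ := by
  have hwalk {u v : V} (p : T.Walk u v) : (u ∈ S ↔ u ∈ A) ↔ (v ∈ S ↔ v ∈ A) := by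
    induction p with
    | nil => rfl
    | cons h _ ih =>
      rw [← ih, mem_iff_notMem_of_adj hA h, mem_iff_notMem_of_adj hS h]
      exact not_iff_not
  obtain ⟨r⟩ := hT.nonempty
  refine (em (r ∈ S ↔ r ∈ A)).imp (fun hr => Set.ext fun v => ?_) fun hr => Set.ext fun v => ?_
  all_goals obtain ⟨p⟩ := hT.preconnected r v
  · exact (hwalk p).1 hr
  · have := (hwalk p).not.1 hr
    rw [Set.mem_compl_iff]
    tauto

lemma isBipartiteWith_compl_of_indepCover {S : Set V} (hSi : T.IsIndepSet S)
    (hSc : T.IsVertexCover S) : T.IsBipartiteWith S Sᶜ := by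
  refine ⟨disjoint_compl_right, fun u v huv => ?_⟩
  rcases hSc huv with hu | hv
  · exact .inl ⟨hu, fun hv => hSi hu hv huv.ne huv⟩
  · exact .inr ⟨fun hu => hSi hu hv huv.ne huv, hv⟩

lemma subsingleton_starCenter_preimage_inr [Fintype V] (C : Finset V) (e : T.edgeSet) :
    (starCenter C ⁻¹' {.inr e}).Subsingleton := fun _ h₁ _ h₂ =>
  (starCenter_eq_inr_iff.1 h₁).1.trans (starCenter_eq_inr_iff.1 h₂).1.symm

lemma subsingleton_starCenter_preimage_inl [Fintype V] (C : Finset V) {v : V}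
    (hv : (T.neighborSet v).ncard = 1) : (starCenter (T := T) C ⁻¹' {.inl v}).Subsingleton := by
  obtain ⟨w, hw⟩ := Set.ncard_eq_one.1 hv
  have key {e : T.edgeSet} (he : starCenter C e = .inl v) : (e : Sym2 V) = s(v, w) := by
    obtain ⟨x, hx⟩ := Sym2.mem_iff_exists.1 (mem_of_starCenter_eq_inl he)
    have hvx : x ∈ T.neighborSet v := (mem_edgeSet T).1 (hx ▸ e.2)
    rw [hw] at hvx
    rw [hx, Set.mem_singleton_iff.1 hvx]
  exact fun _ h₁ _ h₂ => Subtype.ext ((key h₁).trans (key h₂).symm)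

lemma isVertexCover_iff_forall_exists_mem_edge {S : Set V} :
    T.IsVertexCover S ↔ ∀ e : T.edgeSet, ∃ v ∈ (e : Sym2 V), v ∈ S := by
  simp only [IsVertexCover, Subtype.forall, Sym2.forall, mem_edgeSet, Sym2.mem_iff,
    exists_eq_or_imp, exists_eq_left]

lemma card_le_card_starCenters [Fintype V] (C : Finset V) : #C ≤ #(starCenters T C) := by
  rw [starCenters, card_disjSum]
  exact Nat.le_add_right _ _

lemma card_starCenters_of_isVertexCover [Fintype V] (hC : T.IsVertexCover (C : Set V)) :
    #(starCenters T C) = #C := by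
  rw [isVertexCover_iff_forall_exists_mem_edge] at hC
  rw [starCenters, filter_false_of_mem fun e _ h => ?_, card_disjSum, card_empty, add_zero]
  obtain ⟨v, hve, hv⟩ := hC e
  exact h v hve hv

lemma exists_starCenter_preimage_subsingleton [Fintype V] (hT : T.Connected)
    (hA : T.IsBipartiteWith A Aᶜ) (hcard : A.ncard ≤ Aᶜ.ncard) (hδ : minDegreeOn T A = 1)
    {C₀ : Finset V} (hC₀ : T.IsIndepSet (C₀ : Set V)) :
    ∃ C : Finset V, T.IsIndepSet (C : Set V) ∧ #(starCenters T C) ≤ #(starCenters T C₀) ∧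
      ∃ j ∈ starCenters T C, (starCenter C ⁻¹' {j}).Subsingleton := by
  by_cases hcover : T.IsVertexCover (C₀ : Set V)
  · have hAC : A.ncard ≤ #C₀ := by
      rw [← Set.ncard_coe_finset]
      rcases eq_or_eq_compl_of_isBipartiteWith hT hA
        (isBipartiteWith_compl_of_indepCover hC₀ hcover) with h | h <;> rw [h]
      exact hcard
    have hAi : T.IsIndepSet (A.toFinset : Set V) := fun u hu w hw _ huw => by
      rw [Set.coe_toFinset] at hu hw
      exact (mem_iff_notMem_of_adj hA huw).1 hu hw
    have hAcover : T.IsVertexCover (A.toFinset : Set V) := fun u w huw => by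
      rw [Set.coe_toFinset]
      exact (hA.mem_of_adj huw).imp And.left And.right
    obtain ⟨v, hvA, hv⟩ := exists_ncard_neighborSet_eq_one hδ
    refine ⟨A.toFinset, hAi, ?_, .inl v, by simpa, subsingleton_starCenter_preimage_inl _ hv⟩
    calc #(starCenters T A.toFinset) = A.ncard := by
          rw [card_starCenters_of_isVertexCover hAcover, Set.ncard_eq_toFinset_card']
      _ ≤ #(starCenters T C₀) := hAC.trans (card_le_card_starCenters C₀)
  · simp only [isVertexCover_iff_forall_exists_mem_edge, not_forall, not_exists, not_and] at hcover
    obtain ⟨e, he⟩ := hcover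
    exact ⟨C₀, hC₀, le_rfl, .inr e, inr_mem_starCenters.2 he,
      subsingleton_starCenter_preimage_inr C₀ e⟩

end IndepCover

section Main

variable {V : Type*} {T : SimpleGraph V} {A : Set V} {m : ℕ}

lemma exists_isBipartite_mem_decompositionFamily_edgeBlowup [Finite V] (hm : 2 ≤ m)
    (hA : T.IsBipartiteWith A Aᶜ) (e : T.edgeSet) :
    ∃ F ∈ decompositionFamily (edgeBlowup T (m + 2)), F.2.IsBipartite := by
  have := Fintype.ofFinite V
  obtain ⟨F, hF, ⟨f⟩⟩ := exists_mem_decompositionFamily (chromaticNumber_edgeBlowup hm hA e)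
    (edgeBlowup_isContained_join_matching hm hA) completeEquipartiteGraph_colorable
  exact ⟨F, hF, (starForest_isBipartite _ _).of_hom f.toHom⟩

lemma exists_card_starCenters_le_familyIndepCoverNum [Fintype V] (hm : 2 ≤ m)
    (hT : T.Connected) (hA : T.IsBipartiteWith A Aᶜ) (hcard : A.ncard ≤ Aᶜ.ncard)
    (hδ : minDegreeOn T A = 1) (e : T.edgeSet) :
    ∃ C : Finset V, T.IsIndepSet (C : Set V) ∧
      #(starCenters T C) ≤ familyIndepCoverNum (decompositionFamily (edgeBlowup T (m + 2))) ∧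
      ∃ j ∈ starCenters T C, (starCenter C ⁻¹' {j}).Subsingleton := by
  obtain ⟨F, hF, X, hXc, hXi, hX⟩ :=
    exists_indepCover_family (exists_isBipartite_mem_decompositionFamily_edgeBlowup hm hA e)
  obtain ⟨v, t, hL⟩ :=
    isContained_join_of_mem_decompositionFamily (chromaticNumber_edgeBlowup hm hA e) hF
  obtain ⟨C₀, hC₀, hC₀X⟩ := exists_indepSet_of_indepCover (zero_lt_two.trans_le hm) hXc hXi hL
  obtain ⟨C, hC, hCC₀, hj⟩ := exists_starCenter_preimage_subsingleton hT hA hcard hδ hC₀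
  exact ⟨C, hC, hCC₀.trans (hC₀X.trans hX.le), hj⟩

end Main

end BlowupTuran

theorem theorem1p4_general {V : Type*} [Finite V] (T : SimpleGraph V) (hT : T.Connected)
    (p : ℕ) (hp : 3 ≤ p)
    (A : Set V) (hA : T.IsBipartiteWith A Aᶜ) (hcard : A.ncard ≤ Aᶜ.ncard)
    (hδ : minDegreeOn T A = 1)
    (𝓜 : GraphFamily) (h𝓜 : 𝓜 = decompositionFamily (edgeBlowup T (p + 1)))
    (q : ℕ) (hq : q = familyIndepCoverNum 𝓜)
    (𝓑 : GraphFamily) (h𝓑 : 𝓑 = coveringFamily 𝓜) :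
    ∃ n₀ : ℕ, ∀ n ≥ n₀,
      (edgeBlowup T (p + 1)).extremalNumber n = hPrime n p q + familyEx (q - 1) 𝓑 ∧
      ∀ G : SimpleGraph (Fin n),
        G ∈ graphEX n (edgeBlowup T (p + 1)) ↔
          ∃ Q ∈ familyEX (q - 1) 𝓑, Nonempty (G ≃g turanWith n p q Q) := by
  classical
  have := Fintype.ofFinite V
  obtain ⟨m, rfl⟩ : ∃ m, p = m + 1 := ⟨p - 1, by omega⟩
  subst h𝓜 hq h𝓑
  have hm : 2 ≤ m := by omega
  obtain ⟨v, -, hv⟩ := exists_ncard_neighborSet_eq_one hδ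
  obtain ⟨w, hvw⟩ := Set.nonempty_of_ncard_ne_zero (hv.trans_ne one_ne_zero)
  have hχ := chromaticNumber_edgeBlowup hm hA ⟨s(v, w), hvw⟩
  obtain ⟨C, hC, hCq, j, hj, hsingle⟩ :=
    exists_card_starCenters_le_familyIndepCoverNum hm hT hA hcard hδ ⟨s(v, w), hvw⟩
  have hq : 0 < familyIndepCoverNum (decompositionFamily (edgeBlowup T (m + 2))) :=
    (Finset.card_pos.2 ⟨j, hj⟩).trans_le hCq
  obtain ⟨n₀, h⟩ := eventually_extremalTuranWith (zero_lt_two.trans_le hm)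
    (SimpleGraph.ne_bot_iff_exists_adj.2 ⟨_, _, edgeBlowup_adj_inl_inl.2 hvw⟩)
    (edgeBlowup_isContained_join_matching hm hA)
    (edgeBlowup_isContained_join_starForest hm hA hC (by omega) hj hsingle)
    (fun _ => (free_join_iff_familyFree_coveringFamily (zero_lt_two.trans_le hm) hχ hq).1)
    (fun Q hQ n h => (free_join_iff_familyFree_coveringFamily (zero_lt_two.trans_le hm) hχ hq).2 hQ
      (isContained_join_completeEquipartiteGraph h (turanGraph_colorable _ m.succ_pos)))
    (familyEX_nonempty (familyFree_coveringFamily_bot hq))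
  exact ⟨n₀, fun n hn => ⟨(h n hn).extremalNumber_eq, (h n hn).mem_graphEX_iff⟩⟩

theorem theorem1p4 {V : Type*} [Fintype V] (T : SimpleGraph V) (hT : T.IsTree)
    (p : ℕ) (hp : 3 ≤ p)
    (A B : Set V) (hAB : T.IsBipartiteWith A B) (hcover : A ∪ B = Set.univ)
    (hcard : A.ncard ≤ B.ncard)
    (hδ : minDegreeOn T A = 1) (hα : B.ncard < T.indepNum)
    (𝓜 : GraphFamily) (h𝓜 : 𝓜 = decompositionFamily (edgeBlowup T (p + 1)))
    (q : ℕ) (hq : q = familyIndepCoverNum 𝓜)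
    (𝓑 : GraphFamily) (h𝓑 : 𝓑 = coveringFamily 𝓜) :
    ∃ n₀ : ℕ, ∀ n ≥ n₀,
      (edgeBlowup T (p + 1)).extremalNumber n = hPrime n p q + familyEx (q - 1) 𝓑 ∧
      ∀ G : SimpleGraph (Fin n),
        G ∈ graphEX n (edgeBlowup T (p + 1)) ↔
          ∃ Q ∈ familyEX (q - 1) 𝓑, Nonempty (G ≃g turanWith n p q Q) := by
  obtain rfl : Aᶜ = B := (IsCompl.of_eq hAB.disjoint.eq_bot hcover).compl_eq
  exact theorem1p4_general T hT.connected p hp A hAB hcard hδ 𝓜 h𝓜 q hq 𝓑 h𝓑
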